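/- Let $c>0$, $T>0$, and let $$f_t(x)=\mathbf 1_{\{x>0\}}\frac{ct}{\sqrt{2\pi}\,x^{3/2}}\exp\Big(-\frac{c^2t^2}{2x}\Big)$$ be the transition densities of the stable-1/2 subordinator $\{S_t\}$ with activity parameter $c$. Let $\nu$ be a probability law on $(0,\infty)$ with finite mean, and let $\{\xi_{tT}\}_{0\le t\le T}$ be a stable-1/2 random bridge with terminal law $\nu$: $\xi_{0T}=0$ a.s., $U_T:=\xi_{TT}$ has law $\nu$, and for all $0<t_1<\dots<t_n<T$, all $x\in\mathbb R^n$ and $\nu$-a.e. $z$, $$\mathbb Q[\xi_{t_1T}\le x_1,\dots,\xi_{t_nT}\le x_n\mid\xi_{TT}=z]=\mathbb Q[S_{t_1}\le x_1,\dots,S_{t_n}\le x_n\mid S_T=z],$$ where the right-hand side is given by the conditional density $\prod_{i=1}^n f_{t_i-t_{i-1}}(y_i-y_{i-1})\,f_{T-t_n}(z-y_n)/f_T(z)$ of $(S_{t_1},\dots,S_{t_n})$ (with $t_0=y_0=0$). Let $\mathcal F^\xi_s=\sigma(\xi_{uT}:u\le s)$, $U_{sT}=\mathbb E[U_T\mid\mathcal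 F^\xi_s]$, let $$\nu_s(dz)=\frac{\psi_s(dz;\xi_{sT})}{\psi_s(\mathbb R;\xi_{sT})},\qquad \psi_s(dz;x)=\frac{f_{T-s}(z-x)}{f_T(z)}\,\nu(dz),$$ and for $0<t<T$, $z>0$ let $$f_{tT}(y;z)=\frac{f_t(y)f_{T-t}(z-y)}{f_T(z)},\quad F_{tT}(y;z)=\int_{-\infty}^y f_{tT}(u;z)\,du,\quad M_{tT}(y;z)=\int_0^y u\,f_{tT}(u;z)\,du .$$ Fix $0\le s<t<T$ and $K>0$. Then $\nu_s$ is the $\mathcal F^\xi_s$-conditional law of $U_T$, i.e. $\mathbb Q[U_T\in A\mid\mathcal F^\xi_s]=\nu_s(A)$ a.s. for every Borel set $A$; a.s. it has finite mean $U_{sT}=\int_{\xi_{sT}}^\infty z\,\nu_s(dz)$; and $(\xi_{tT}-K)^+$ is integrable with, almost surely, $$\begin{aligned} D_{st}&=\mathbb E\big[(\xi_{tT}-K)^+\mid\mathcal F^\xi_s\big]\\ &=\frac{T-t}{T-s}\xi_{sT}+\frac{t-s}{T-s}U_{sT}-K\\ &\quad+\mathbf 1_{\{K>\xi_{sT}\}}(K-\xi_{sT})\int_{\xi_{sT}}^\infty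 F_{t-s,T-s}(K-\xi_{sT};z-\xi_{sT})\,\nu_s(dz)\\ &\quad-\mathbf 1_{\{K>\xi_{sT}\}}\int_{\xi_{sT}}^\infty M_{t-s,T-s}(K-\xi_{sT};z-\xi_{sT})\,\nu_s(dz), \end{aligned}$$ where the last two integrands are $\nu_s$-integrable a.s. on $\{K>\xi_{sT}\}$. Here $F$ and $M$ are explicit: with $\Phi$ the standard normal distribution function, for $0<t<T$ and $0<y<z$, $$F_{tT}(y;z)=\Phi\Big[\tfrac{c(Ty-tz)}{\sqrt{yz(z-y)}}\Big]+\Big(1-\tfrac{2t}{T}\Big)e^{2c^2t(T-t)/z}\,\Phi\Big[\tfrac{c((2t-T)y-tz)}{\sqrt{yz(z-y)}}\Big],$$ $$M_{tT}(y;z)=\tfrac tT z\Big\{\Phi\Big[\tfrac{c(Ty-tz)}{\sqrt{yz(z-y)}}\Big]-e^{2c^2t(T-t)/z}\,\Phi\Big[\tfrac{c((2t-T)y-tz)}{\sqrt{yz(z-y)}}\Big]\Big\},$$ while $F_{tT}(y;z)=1$ and $M_{tT}(y;z)=\frac tT z$ for $y\ge z>0$. -/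

import Mathlib

open MeasureTheory ProbabilityTheory Set
open scoped NNReal ENNReal

namespace StableHalf

noncomputable section

/-- The density `f_t` of `S_t`, where `S` is the stable-1/2 subordinator with activity
parameter `c`. -/
def stableDensity (c t x : ℝ) : ℝ :=
  if 0 < x then
    c * t / (√(2 * Real.pi) * x ^ (3 / 2 : ℝ)) * Real.exp (-(1 / 2) * (c ^ 2 * t ^ 2 / x))
  else 0

/-- For `t = (t₁ < ⋯ < tₙ)`, the joint density of `(S_{t₁}, …, S_{tₙ})` at `x = (x₁, …, xₙ)`:
the product of `f_{tᵢ - tᵢ₋₁}(xᵢ - xᵢ₋₁)` with `t₀ = 0` and `x₀ = 0` (independent stationary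
increments and `S₀ = 0`). -/
def jointDensity (c : ℝ) {n : ℕ} (t x : Fin n → ℝ) : ℝ :=
  ∏ i : Fin n,
    stableDensity c (t i - (Fin.cons 0 t : Fin (n + 1) → ℝ) i.castSucc)
      (x i - (Fin.cons 0 x : Fin (n + 1) → ℝ) i.castSucc)

/-- The law of `(S_{t₁}, …, S_{tₙ})` conditionally on `S_T = z`, i.e. the finite-dimensional law
of the stable-1/2 bridge to the value `z` at time `T`. As `{S_T = z}` is a null event, this is the
version with the conditional density: the joint density of `(S_{t₁}, …, S_{tₙ}, S_T)` at
`(x₁, …, xₙ, z)` divided by the density of `S_T` at `z`. -/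
def bridgeLaw (c T : ℝ) {n : ℕ} (t : Fin n → ℝ) (z : ℝ) : Measure (Fin n → ℝ) :=
  volume.withDensity fun x ↦ ENNReal.ofReal
    (jointDensity c (Fin.snoc t T : Fin (n + 1) → ℝ) (Fin.snoc x z : Fin (n + 1) → ℝ) /
      stableDensity c T z)

/-- `ξ` is (on the time interval `[0, T]`) a stable-1/2 random bridge with activity parameter `c`
and terminal law `ν`: it starts at `0`, `ξ_T` has law `ν`, and for `0 < t₁ < ⋯ < tₙ < T`
`ℚ[ξ_{t₁} ≤ x₁, …, ξ_{tₙ} ≤ xₙ | ξ_T = z] = ℚ[S_{t₁} ≤ x₁, …, S_{tₙ} ≤ xₙ | S_T = z]`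
for `ν`-almost every `z`. -/
structure IsStableHalfRandomBridge {Ω : Type*} [MeasurableSpace Ω] (Q : Measure Ω)
    [IsProbabilityMeasure Q] (c : ℝ) (T : ℝ≥0) (ν : Measure ℝ) (ξ : ℝ≥0 → Ω → ℝ) : Prop where
  stronglyMeasurable : ∀ u, StronglyMeasurable (ξ u)
  start_zero : ∀ᵐ ω ∂Q, ξ 0 ω = 0
  terminal_law : Q.map (ξ T) = ν
  bridge_law : ∀ (n : ℕ) (t : Fin n → ℝ≥0), StrictMono t → (∀ i, 0 < t i ∧ t i < T) →
    ∀ x : Fin n → ℝ, ∀ᵐ z ∂ν,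
      condDistrib (fun ω i ↦ ξ (t i) ω) (ξ T) Q z {y | ∀ i, y i ≤ x i} =
        bridgeLaw c T (fun i ↦ (t i : ℝ)) z {y | ∀ i, y i ≤ x i}

/-- The bridge density `f_{tT}(y; z)`: the density at `y` of the time-`t` value of the stable-1/2
bridge to the value `z` at time `T`. -/
def bridgeDensity (c t T y z : ℝ) : ℝ :=
  stableDensity c t y * stableDensity c (T - t) (z - y) / stableDensity c T z

/-- The bridge distribution function `F_{tT}(y; z)`. -/
def bridgeCDF (c t T y z : ℝ) : ℝ :=
  ∫ u in Iic y, bridgeDensity c t T u z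

/-- The incomplete first moment `M_{tT}(y; z)` of the bridge. -/
def bridgeMoment (c t T y z : ℝ) : ℝ :=
  ∫ u in (0 : ℝ)..y, u * bridgeDensity c t T u z

/-- The standard normal distribution function. -/
def Phi (x : ℝ) : ℝ := cdf (gaussianReal 0 1) x

/-- The unnormalised measure `ψ_s(dz; x) = f_{T-s}(z - x) / f_T(z) ν(dz)`. -/
def psi (c : ℝ) (T : ℝ) (ν : Measure ℝ) (s x : ℝ) : Measure ℝ :=
  ν.withDensity fun z ↦ ENNReal.ofReal (stableDensity c (T - s) (z - x) / stableDensity c T z)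

/-- The posterior law `ψ_s(dz; x) / ψ_s(ℝ; x)`; the measure `ν_s` is its value at `x = ξ_s`. -/
def posterior (c : ℝ) (T : ℝ) (ν : Measure ℝ) (s x : ℝ) : Measure ℝ :=
  (psi c T ν s x univ)⁻¹ • psi c T ν s x

end

end StableHalf

open Filter Topology

namespace StableHalf

/-! Given its value `z` at time `T`, the process is a stable-1/2 bridge. The joint density of the
path at `t₁ < ⋯ < tₙ = s` together with the terminal value factors into the free subordinator
density of the path and the weight `f_{T-s}(z - ξ_s) / f_T(z)` against `ν`. The past therefore
enters the weight on `z` only through `ξ_s`, and normalising the weight gives the posterior `ν_s`.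
Inserting one more time `u` and applying the pointwise identity `stableDensity_mul_stableDensity`
shows that, given the past and `z`, the value at `u` has the density of a bridge from `ξ_s` to `z`.
This is proved on cylinders (`lintegral_cylinder`), extended to the whole past by a π-λ argument
(`setLIntegral_eq`), and read as a conditional expectation (`condExp_ae_eq`).

The remaining work is one bridge expectation. Write `(u - k)⁺ = (u - k) - (u - k) 1_{u ≤ k}`: the
first term needs the mass `1` and the mean `r z / R` of the bridge, the second is `M - k F`.
Averaging over `ν_s` with `k = K - ξ_s` gives the formula.

Mass, mean, `F` and `M` all come from a single primitive, `closedForm`. The two normal densities in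
its derivative are proportional, so the derivative is that density times an explicit function of
`y`; one choice of `κ` gives the bridge density, another a multiple of `y` times it. The limits of
the primitive at `0` and `z` give the constants. -/

/-! ### The normal distribution function and a one-sided fundamental theorem of calculus -/

lemma hasDerivAt_Phi (x : ℝ) : HasDerivAt Phi (gaussianPDFReal 0 1 x) x := by
  have hcont : Continuous (gaussianPDFReal 0 1) := by
    unfold gaussianPDFReal; fun_prop
  have hint : Integrable (gaussianPDFReal 0 1) := integrable_gaussianPDFReal 0 1
  have key : ∀ u, Phi u = ∫ v in Iic u, gaussianPDFReal 0 1 v := by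
    intro u
    rw [Phi, cdf_eq_real, Measure.real, gaussianReal_apply_eq_integral _ (by simp),
      ENNReal.toReal_ofReal]
    exact setIntegral_nonneg measurableSet_Iic fun v _ ↦ gaussianPDFReal_nonneg 0 1 v
  have key2 : Phi = fun u ↦ (∫ v in (0 : ℝ)..u, gaussianPDFReal 0 1 v) + Phi 0 := by
    funext u
    rw [← intervalIntegral.integral_Iic_sub_Iic hint.integrableOn hint.integrableOn, ← key, ← key]
    ring
  rw [key2]
  exact (intervalIntegral.integral_hasDerivAt_right (hcont.intervalIntegrable _ _)
    (hcont.stronglyMeasurableAtFilter _ _) hcont.continuousAt).add_const _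

lemma tendsto_Phi_atTop : Tendsto Phi atTop (𝓝 1) := tendsto_cdf_atTop _

lemma tendsto_Phi_atBot : Tendsto Phi atBot (𝓝 0) := tendsto_cdf_atBot _

/-- Fundamental theorem of calculus on an open interval, for a nonnegative derivative and a
primitive with one-sided limits; integrability is part of the conclusion. -/
lemma integrableOn_and_integral_of_deriv_nonneg {a b fa fb : ℝ} (hab : a < b) {G g : ℝ → ℝ}
    (hderiv : ∀ x ∈ Ioo a b, HasDerivAt G (g x) x) (hg : ∀ x ∈ Ioo a b, 0 ≤ g x)
    (ha : Tendsto G (𝓝[>] a) (𝓝 fa)) (hb : Tendsto G (𝓝[<] b) (𝓝 fb)) :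
    IntegrableOn g (Ioc a b) ∧ ∫ x in a..b, g x = fb - fa := by
  have hcG : ContinuousOn G (Ioo a b) := fun x hx ↦
    (hderiv x hx).continuousAt.continuousWithinAt
  -- Extending `G` by its one-sided limits makes it continuous on `[a, b]`; a nonnegative derivative
  -- of such a function is automatically integrable.
  have hint : IntegrableOn g (Ioc a b) := by
    refine intervalIntegral.integrableOn_deriv_of_nonneg
      (continuousOn_Icc_extendFrom_Ioo hcG ha hb) (fun x hx ↦ ?_) hg
    refine (hderiv x hx).congr_of_eventuallyEq ?_
    filter_upwards [Ioo_mem_nhds hx.1 hx.2] with y hy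
    exact extendFrom_extends hcG y hy
  exact ⟨hint, intervalIntegral.integral_eq_sub_of_hasDerivAt_of_tendsto hab hderiv
    ((intervalIntegrable_iff_integrableOn_Ioc_of_le hab.le).2 hint) ha hb⟩

/-! ### Stable-1/2 and bridge densities -/

lemma stableDensity_nonneg {c t : ℝ} (hc : 0 ≤ c) (ht : 0 ≤ t) (x : ℝ) :
    0 ≤ stableDensity c t x := by
  unfold stableDensity
  split_ifs <;> positivity

lemma stableDensity_of_nonpos (c t : ℝ) {x : ℝ} (hx : x ≤ 0) : stableDensity c t x = 0 :=
  if_neg hx.not_gt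

lemma stableDensity_pos {c t x : ℝ} (hc : 0 < c) (ht : 0 < t) (hx : 0 < x) :
    0 < stableDensity c t x := by
  rw [stableDensity, if_pos hx]
  positivity

@[fun_prop]
lemma measurable_stableDensity (c t : ℝ) : Measurable (stableDensity c t) := by
  unfold stableDensity
  exact Measurable.ite measurableSet_Ioi (by fun_prop) measurable_const

@[fun_prop]
lemma measurable_bridgeDensity (c r R : ℝ) :
    Measurable fun p : ℝ × ℝ ↦ bridgeDensity c r R p.1 p.2 := by
  unfold bridgeDensity
  fun_prop

lemma bridgeDensity_nonneg {c r R : ℝ} (hc : 0 ≤ c) (hr : 0 ≤ r) (hR : r ≤ R) (y z : ℝ) :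
    0 ≤ bridgeDensity c r R y z :=
  div_nonneg (mul_nonneg (stableDensity_nonneg hc hr _) (stableDensity_nonneg hc (by linarith) _))
    (stableDensity_nonneg hc (by linarith) _)

lemma bridgeDensity_of_nonpos (c r R : ℝ) {y : ℝ} (z : ℝ) (hy : y ≤ 0) :
    bridgeDensity c r R y z = 0 := by
  simp [bridgeDensity, stableDensity_of_nonpos _ _ hy]

lemma bridgeDensity_of_le (c r R : ℝ) {y z : ℝ} (hy : z ≤ y) : bridgeDensity c r R y z = 0 := by
  simp [bridgeDensity, stableDensity_of_nonpos _ _ (sub_nonpos.2 hy)]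

/-! ### Gaussian form of the bridge density and its primitive -/

/-- The argument `c (a y - r z) / √(y z (z - y))` of the normal distribution function in the closed
forms of the bridge distribution function and of its incomplete first moment. -/
noncomputable def gaussArg (c a r y z : ℝ) : ℝ := c * (a * y - r * z) / √(y * z * (z - y))

lemma hasDerivAt_gaussArg (c a r : ℝ) {y z : ℝ} (hy : 0 < y) (hyz : y < z) :
    HasDerivAt (fun u ↦ gaussArg c a r u z)
      (c * z ^ 2 * (a * y + r * z - 2 * r * y) /
        (2 * (y * z * (z - y)) * √(y * z * (z - y)))) y := by
  have hD : 0 < y * z * (z - y) := mul_pos (mul_pos hy (hy.trans hyz)) (sub_pos.2 hyz)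
  have h1 : HasDerivAt (fun u ↦ u * z * (z - u)) (z * (z - 2 * y)) y := by
    have := ((hasDerivAt_id y).mul_const z).mul ((hasDerivAt_id y).const_sub z)
    refine this.congr_deriv ?_
    simp; ring
  have h2 : HasDerivAt (fun u ↦ c * (a * u - r * z)) (c * a) y := by
    have := (((hasDerivAt_id y).const_mul a).sub_const (r * z)).const_mul c
    refine this.congr_deriv ?_
    simp
  have hs : 0 < √(y * z * (z - y)) := Real.sqrt_pos.2 hD
  have hs2 : √(y * z * (z - y)) ^ 2 = y * z * (z - y) := Real.sq_sqrt hD.le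
  refine (h2.div (h1.sqrt hD.ne') hs.ne').congr_deriv ?_
  generalize √(y * z * (z - y)) = w at *
  have hw : w ≠ 0 := hs.ne'
  rw [← hs2]
  field_simp
  rw [hs2]
  ring

/-- With `q`, `p` the arguments for `a = R` and `a = 2r - R`, difference of squares gives `p² - q² =
4 c² r (R - r) / z`, free of `y`. This is why the exponential factor appears in the closed forms. -/
lemma exp_mul_gaussianPDFReal_gaussArg (c : ℝ) {r R y z : ℝ} (hy : 0 < y) (hyz : y < z) :
    Real.exp (2 * c ^ 2 * r * (R - r) / z) *
      gaussianPDFReal 0 1 (gaussArg c (2 * r - R) r y z) =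
      gaussianPDFReal 0 1 (gaussArg c R r y z) := by
  have hz : 0 < z := hy.trans hyz
  have hzy : 0 < z - y := sub_pos.2 hyz
  have hD : 0 < y * z * (z - y) := by positivity
  unfold gaussianPDFReal gaussArg
  rw [mul_left_comm, ← Real.exp_add]
  congr 2
  rw [sub_zero, sub_zero, div_pow, div_pow, Real.sq_sqrt hD.le]
  push_cast
  field_simp
  ring

lemma stableDensity_eq (c t : ℝ) {x : ℝ} (hx : 0 < x) :
    stableDensity c t x =
      c * t / (√(2 * Real.pi) * (x * √x)) * Real.exp (-(1 / 2) * (c ^ 2 * t ^ 2 / x)) := by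
  have : x ^ (3 / 2 : ℝ) = x * √x := by
    rw [show (3 / 2 : ℝ) = 1 + 1 / 2 by norm_num, Real.rpow_add hx, Real.rpow_one,
      Real.sqrt_eq_rpow]
  rw [stableDensity, if_pos hx, this]

/-- The three exponents combine into one square: `r²/y + (R - r)²/(z - y) - R²/z = (R y - r z)² / (y
z (z - y))`. -/
lemma bridgeDensity_eq {c r R y z : ℝ} (hc : 0 < c) (hr : 0 < r) (hR : r < R) (hy : 0 < y)
    (hyz : y < z) :
    bridgeDensity c r R y z = gaussianPDFReal 0 1 (gaussArg c R r y z) *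
      (c * r * (R - r) * z ^ 3 / (R * (y * z * (z - y)) * √(y * z * (z - y)))) := by
  have hz : 0 < z := hy.trans hyz
  have hzy : 0 < z - y := sub_pos.2 hyz
  have hR0 : 0 < R := hr.trans hR
  have hD : 0 < y * z * (z - y) := by positivity
  have hexp : Real.exp (-(1 / 2) * (c ^ 2 * r ^ 2 / y)) *
      Real.exp (-(1 / 2) * (c ^ 2 * (R - r) ^ 2 / (z - y))) =
      Real.exp (-(gaussArg c R r y z) ^ 2 / 2) *
        Real.exp (-(1 / 2) * (c ^ 2 * R ^ 2 / z)) := by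
    rw [← Real.exp_add, ← Real.exp_add]
    congr 1
    rw [gaussArg, div_pow, Real.sq_sqrt hD.le]
    field_simp
    ring
  have hpdf : gaussianPDFReal 0 1 (gaussArg c R r y z) =
      (√(2 * Real.pi))⁻¹ * Real.exp (-(gaussArg c R r y z) ^ 2 / 2) := by
    simp [gaussianPDFReal]
  have hsz := Real.sqrt_pos.2 hz
  have hsy := Real.sqrt_pos.2 hy
  have hszy := Real.sqrt_pos.2 hzy
  have hsp : 0 < √(2 * Real.pi) := by positivity
  rw [bridgeDensity, stableDensity_eq _ _ hy, stableDensity_eq _ _ hzy, stableDensity_eq _ _ hz,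
    hpdf, Real.sqrt_mul (by positivity : 0 ≤ y * z), Real.sqrt_mul hy.le]
  rw [mul_mul_mul_comm, hexp]
  have hz2 : √z ^ 2 = z := Real.sq_sqrt hz.le
  field_simp
  rw [hz2]

/-- The closed form `Φ(q) + κ e^{2 c² r (R - r) / z} Φ(p)`; `κ = 1 - 2 r / R` gives the bridge
distribution function, `κ = -1` the normalised incomplete first moment. -/
noncomputable def closedForm (κ c r R y z : ℝ) : ℝ :=
  Phi (gaussArg c R r y z) +
    κ * Real.exp (2 * c ^ 2 * r * (R - r) / z) * Phi (gaussArg c (2 * r - R) r y z)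

lemma hasDerivAt_closedForm (κ c : ℝ) {r R y z : ℝ} (hy : 0 < y) (hyz : y < z) :
    HasDerivAt (fun u ↦ closedForm κ c r R u z)
      (gaussianPDFReal 0 1 (gaussArg c R r y z) *
        (c * z ^ 2 * ((R * y + r * z - 2 * r * y) + κ * (r * z - R * y)) /
          (2 * (y * z * (z - y)) * √(y * z * (z - y))))) y := by
  have h1 := (hasDerivAt_Phi (gaussArg c R r y z)).comp y (hasDerivAt_gaussArg c R r hy hyz)
  have h2 := ((hasDerivAt_Phi (gaussArg c (2 * r - R) r y z)).comp y
    (hasDerivAt_gaussArg c (2 * r - R) r hy hyz)).const_mul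
      (κ * Real.exp (2 * c ^ 2 * r * (R - r) / z))
  refine (h1.add h2).congr_deriv ?_
  rw [mul_assoc κ, ← mul_assoc (Real.exp _), exp_mul_gaussianPDFReal_gaussArg c hy hyz]
  ring

/-- At `y = 0` the numerator is `-c r z < 0` whatever `a` is, while the denominator tends to `0`
from above. At `y = z` the numerator is `c (a - r) z`, so there the sign of `a - r` decides between
the two infinities. -/
lemma tendsto_gaussArg_left {c r z : ℝ} (a : ℝ) (hc : 0 < c) (hr : 0 < r) (hz : 0 < z) :
    Tendsto (fun y ↦ gaussArg c a r y z) (𝓝[>] 0) atBot := by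
  have h1 : Tendsto (fun y ↦ c * (a * y - r * z)) (𝓝[>] 0) (𝓝 (c * (a * 0 - r * z))) :=
    tendsto_nhdsWithin_of_tendsto_nhds (Continuous.tendsto (by fun_prop) _)
  have h2 : Tendsto (fun y ↦ √(y * z * (z - y))) (𝓝[>] 0) (𝓝[>] 0) := by
    refine tendsto_nhdsWithin_iff.2 ⟨?_, ?_⟩
    · have : Tendsto (fun y ↦ √(y * z * (z - y))) (𝓝 0) (𝓝 (√(0 * z * (z - 0)))) :=
        Continuous.tendsto (by fun_prop) _
      simpa using tendsto_nhdsWithin_of_tendsto_nhds this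
    · filter_upwards [Ioo_mem_nhdsGT hz] with y hy
      exact Real.sqrt_pos.2 (mul_pos (mul_pos hy.1 hz) (sub_pos.2 hy.2))
  refine (h1.neg_mul_atTop ?_ (tendsto_inv_nhdsGT_zero.comp h2))
  have := mul_pos hc (mul_pos hr hz)
  linarith

lemma tendsto_sqrt_nhdsLT {z : ℝ} (hz : 0 < z) :
    Tendsto (fun y ↦ √(y * z * (z - y))) (𝓝[<] z) (𝓝[>] 0) := by
  refine tendsto_nhdsWithin_iff.2 ⟨?_, ?_⟩
  · have : Tendsto (fun y ↦ √(y * z * (z - y))) (𝓝 z) (𝓝 (√(z * z * (z - z)))) :=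
      Continuous.tendsto (by fun_prop) _
    simpa using tendsto_nhdsWithin_of_tendsto_nhds this
  · filter_upwards [Ioo_mem_nhdsLT hz] with y hy
    exact Real.sqrt_pos.2 (mul_pos (mul_pos hy.1 hz) (sub_pos.2 hy.2))

lemma tendsto_gaussArg_right_atTop {c a r z : ℝ} (hc : 0 < c) (ha : r < a) (hz : 0 < z) :
    Tendsto (fun y ↦ gaussArg c a r y z) (𝓝[<] z) atTop := by
  have h1 : Tendsto (fun y ↦ c * (a * y - r * z)) (𝓝[<] z) (𝓝 (c * (a * z - r * z))) :=
    tendsto_nhdsWithin_of_tendsto_nhds (Continuous.tendsto (by fun_prop) _)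
  refine h1.pos_mul_atTop ?_ (tendsto_inv_nhdsGT_zero.comp (tendsto_sqrt_nhdsLT hz))
  rw [← sub_mul]
  exact mul_pos hc (mul_pos (sub_pos.2 ha) hz)

lemma tendsto_gaussArg_right_atBot {c a r z : ℝ} (hc : 0 < c) (ha : a < r) (hz : 0 < z) :
    Tendsto (fun y ↦ gaussArg c a r y z) (𝓝[<] z) atBot := by
  have h1 : Tendsto (fun y ↦ c * (a * y - r * z)) (𝓝[<] z) (𝓝 (c * (a * z - r * z))) :=
    tendsto_nhdsWithin_of_tendsto_nhds (Continuous.tendsto (by fun_prop) _)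
  refine h1.neg_mul_atTop ?_ (tendsto_inv_nhdsGT_zero.comp (tendsto_sqrt_nhdsLT hz))
  rw [← sub_mul]
  exact mul_neg_of_pos_of_neg hc (mul_neg_of_neg_of_pos (sub_neg.2 ha) hz)

lemma tendsto_closedForm_left (κ : ℝ) {c r z : ℝ} (R : ℝ) (hc : 0 < c) (hr : 0 < r) (hz : 0 < z) :
    Tendsto (fun y ↦ closedForm κ c r R y z) (𝓝[>] 0) (𝓝 0) := by
  have h1 := tendsto_Phi_atBot.comp (tendsto_gaussArg_left R hc hr hz)
  have h2 := (tendsto_Phi_atBot.comp (tendsto_gaussArg_left (2 * r - R) hc hr hz)).const_mul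
    (κ * Real.exp (2 * c ^ 2 * r * (R - r) / z))
  simpa [closedForm] using h1.add h2

lemma tendsto_closedForm_right (κ : ℝ) {c r R z : ℝ} (hc : 0 < c) (hR : r < R) (hz : 0 < z) :
    Tendsto (fun y ↦ closedForm κ c r R y z) (𝓝[<] z) (𝓝 1) := by
  have h1 := tendsto_Phi_atTop.comp (tendsto_gaussArg_right_atTop hc hR hz)
  have h2 := (tendsto_Phi_atBot.comp (tendsto_gaussArg_right_atBot (a := 2 * r - R) hc
    (r := r) (by linarith) hz)).const_mul (κ * Real.exp (2 * c ^ 2 * r * (R - r) / z))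
  simpa [closedForm] using h1.add h2

/-! ### Mass, mean, distribution function and expected exceedance of the bridge -/

section ClosedForms

variable {c r R y z : ℝ}

/-- For `κ = 1 - 2 r / R` the terms in `y` of the bracket in `hasDerivAt_closedForm` cancel and `2 r
(R - r) z / R` remains. -/
lemma hasDerivAt_closedForm_bridgeDensity (hc : 0 < c) (hr : 0 < r) (hR : r < R) (hy : 0 < y)
    (hyz : y < z) :
    HasDerivAt (fun u ↦ closedForm (1 - 2 * r / R) c r R u z) (bridgeDensity c r R y z) y := by
  have hR0 : 0 < R := hr.trans hR
  refine (hasDerivAt_closedForm _ c hy hyz).congr_deriv ?_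
  rw [bridgeDensity_eq hc hr hR hy hyz]
  have hzy : 0 < z - y := sub_pos.2 hyz
  have hz : 0 < z := hy.trans hyz
  have hD : 0 < √(y * z * (z - y)) := by positivity
  congr 1
  generalize √(y * z * (z - y)) = w at *
  field_simp
  ring

/-- For `κ = -1` it is the terms in `z` that cancel: the bracket becomes `2 (R - r) y`. -/
lemma hasDerivAt_closedForm_mul_bridgeDensity (hc : 0 < c) (hr : 0 < r) (hR : r < R) (hy : 0 < y)
    (hyz : y < z) :
    HasDerivAt (fun u ↦ r / R * z * closedForm (-1) c r R u z) (y * bridgeDensity c r R y z) y := by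
  have hR0 : 0 < R := hr.trans hR
  refine ((hasDerivAt_closedForm (-1) c hy hyz).const_mul (r / R * z)).congr_deriv ?_
  rw [bridgeDensity_eq hc hr hR hy hyz, mul_left_comm, mul_left_comm y]
  have hzy : 0 < z - y := sub_pos.2 hyz
  have hz : 0 < z := hy.trans hyz
  have hD : 0 < √(y * z * (z - y)) := by positivity
  congr 1
  generalize √(y * z * (z - y)) = w at *
  field_simp
  ring

lemma integral_bridgeDensity_of_lt (hc : 0 < c) (hr : 0 < r) (hR : r < R) (hy : 0 < y)
    (hyz : y < z) :
    ∫ u in (0 : ℝ)..y, bridgeDensity c r R u z = closedForm (1 - 2 * r / R) c r R y z := by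
  rw [(integrableOn_and_integral_of_deriv_nonneg hy
    (fun u hu ↦ hasDerivAt_closedForm_bridgeDensity hc hr hR hu.1 (hu.2.trans hyz))
    (fun u _ ↦ bridgeDensity_nonneg hc.le hr.le hR.le u z)
    (tendsto_closedForm_left _ R hc hr (hy.trans hyz))
    (tendsto_nhdsWithin_of_tendsto_nhds
      (hasDerivAt_closedForm_bridgeDensity hc hr hR hy hyz).continuousAt)).2, sub_zero]

lemma bridgeMoment_of_lt (hc : 0 < c) (hr : 0 < r) (hR : r < R) (hy : 0 < y) (hyz : y < z) :
    bridgeMoment c r R y z = r / R * z * closedForm (-1) c r R y z := by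
  rw [bridgeMoment, (integrableOn_and_integral_of_deriv_nonneg hy
    (fun u hu ↦ hasDerivAt_closedForm_mul_bridgeDensity hc hr hR hu.1 (hu.2.trans hyz))
    (fun u hu ↦ mul_nonneg hu.1.le (bridgeDensity_nonneg hc.le hr.le hR.le u z))
    ((tendsto_closedForm_left _ R hc hr (hy.trans hyz)).const_mul _)
    (tendsto_nhdsWithin_of_tendsto_nhds
      (hasDerivAt_closedForm_mul_bridgeDensity hc hr hR hy hyz).continuousAt)).2]
  simp

lemma bridgeDensity_integrableOn_and_integral (hc : 0 < c) (hr : 0 < r) (hR : r < R)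
    (hz : 0 < z) :
    IntegrableOn (fun u ↦ bridgeDensity c r R u z) (Ioc 0 z) ∧
      ∫ u in (0 : ℝ)..z, bridgeDensity c r R u z = 1 := by
  have := integrableOn_and_integral_of_deriv_nonneg hz
    (fun u hu ↦ hasDerivAt_closedForm_bridgeDensity hc hr hR hu.1 hu.2)
    (fun u _ ↦ bridgeDensity_nonneg hc.le hr.le hR.le u z)
    (tendsto_closedForm_left _ R hc hr hz) (tendsto_closedForm_right _ hc hR hz)
  simpa using this

lemma mul_bridgeDensity_integrableOn_and_integral (hc : 0 < c) (hr : 0 < r) (hR : r < R)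
    (hz : 0 < z) :
    IntegrableOn (fun u ↦ u * bridgeDensity c r R u z) (Ioc 0 z) ∧
      ∫ u in (0 : ℝ)..z, u * bridgeDensity c r R u z = r / R * z := by
  have := integrableOn_and_integral_of_deriv_nonneg hz
    (fun u hu ↦ hasDerivAt_closedForm_mul_bridgeDensity hc hr hR hu.1 hu.2)
    (fun u hu ↦ mul_nonneg hu.1.le (bridgeDensity_nonneg hc.le hr.le hR.le u z))
    ((tendsto_closedForm_left _ R hc hr hz).const_mul _)
    ((tendsto_closedForm_right _ hc hR hz).const_mul _)
  simpa using this

lemma support_bridgeDensity_subset (c r R z : ℝ) :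
    Function.support (fun u ↦ bridgeDensity c r R u z) ⊆ Ioc 0 z := by
  intro u hu
  by_contra h
  rcases not_and_or.1 h with h | h
  · exact hu (bridgeDensity_of_nonpos _ _ _ _ (not_lt.1 h))
  · exact hu (bridgeDensity_of_le _ _ _ (not_le.1 h).le)

lemma support_mul_bridgeDensity_subset (c r R z : ℝ) :
    Function.support (fun u ↦ u * bridgeDensity c r R u z) ⊆ Ioc 0 z := fun _ hu ↦
  support_bridgeDensity_subset c r R z (right_ne_zero_of_mul hu)

lemma integrable_bridgeDensity (hc : 0 < c) (hr : 0 < r) (hR : r < R) (hz : 0 < z) :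
    Integrable fun u ↦ bridgeDensity c r R u z :=
  (integrableOn_iff_integrable_of_support_subset (support_bridgeDensity_subset c r R z)).1
    (bridgeDensity_integrableOn_and_integral hc hr hR hz).1

lemma integrable_mul_bridgeDensity (hc : 0 < c) (hr : 0 < r) (hR : r < R) (hz : 0 < z) :
    Integrable fun u ↦ u * bridgeDensity c r R u z :=
  (integrableOn_iff_integrable_of_support_subset (support_mul_bridgeDensity_subset c r R z)).1
    (mul_bridgeDensity_integrableOn_and_integral hc hr hR hz).1

lemma integral_bridgeDensity (hc : 0 < c) (hr : 0 < r) (hR : r < R) (hz : 0 < z) :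
    ∫ u, bridgeDensity c r R u z = 1 := by
  rw [← setIntegral_eq_integral_of_forall_compl_eq_zero (s := Ioc 0 z) fun u hu ↦
    Function.notMem_support.1 fun h ↦ hu (support_bridgeDensity_subset c r R z h),
    ← intervalIntegral.integral_of_le hz.le]
  exact (bridgeDensity_integrableOn_and_integral hc hr hR hz).2

lemma integral_mul_bridgeDensity (hc : 0 < c) (hr : 0 < r) (hR : r < R) (hz : 0 < z) :
    ∫ u, u * bridgeDensity c r R u z = r / R * z := by
  rw [← setIntegral_eq_integral_of_forall_compl_eq_zero (s := Ioc 0 z) fun u hu ↦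
    Function.notMem_support.1 fun h ↦ hu (support_mul_bridgeDensity_subset c r R z h),
    ← intervalIntegral.integral_of_le hz.le]
  exact (mul_bridgeDensity_integrableOn_and_integral hc hr hR hz).2

lemma bridgeCDF_eq_intervalIntegral (c r R z : ℝ) (hy : 0 ≤ y) :
    bridgeCDF c r R y z = ∫ u in (0 : ℝ)..y, bridgeDensity c r R u z := by
  rw [bridgeCDF, intervalIntegral.integral_of_le hy]
  refine setIntegral_eq_of_subset_of_forall_sdiff_eq_zero measurableSet_Iic Ioc_subset_Iic_self
    fun u hu ↦ bridgeDensity_of_nonpos _ _ _ _ (not_lt.1 fun h ↦ hu.2 ⟨h, hu.1⟩)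

lemma bridgeMoment_eq_setIntegral (c r R z : ℝ) (hy : 0 ≤ y) :
    bridgeMoment c r R y z = ∫ u in Iic y, u * bridgeDensity c r R u z := by
  rw [bridgeMoment, intervalIntegral.integral_of_le hy]
  refine (setIntegral_eq_of_subset_of_forall_sdiff_eq_zero measurableSet_Iic Ioc_subset_Iic_self
    fun u hu ↦ ?_).symm
  rw [bridgeDensity_of_nonpos _ _ _ _ (not_lt.1 fun h ↦ hu.2 ⟨h, hu.1⟩), mul_zero]

lemma bridgeCDF_of_lt (hc : 0 < c) (hr : 0 < r) (hR : r < R) (hy : 0 < y) (hyz : y < z) :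
    bridgeCDF c r R y z = closedForm (1 - 2 * r / R) c r R y z := by
  rw [bridgeCDF_eq_intervalIntegral c r R z hy.le, integral_bridgeDensity_of_lt hc hr hR hy hyz]

lemma bridgeCDF_of_le (hc : 0 < c) (hr : 0 < r) (hR : r < R) (hz : 0 < z) (hzy : z ≤ y) :
    bridgeCDF c r R y z = 1 := by
  rw [bridgeCDF, setIntegral_eq_integral_of_forall_compl_eq_zero (s := Iic y) fun u hu ↦
    bridgeDensity_of_le _ _ _ (hzy.trans (not_le.1 hu).le), integral_bridgeDensity hc hr hR hz]

lemma bridgeMoment_of_le (hc : 0 < c) (hr : 0 < r) (hR : r < R) (hz : 0 < z) (hzy : z ≤ y) :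
    bridgeMoment c r R y z = r / R * z := by
  rw [bridgeMoment_eq_setIntegral c r R z (hz.le.trans hzy),
    setIntegral_eq_integral_of_forall_compl_eq_zero (s := Iic y) fun u hu ↦ by
      rw [bridgeDensity_of_le _ _ _ (hzy.trans (not_le.1 hu).le), mul_zero],
    integral_mul_bridgeDensity hc hr hR hz]

lemma bridgeCDF_nonneg (hc : 0 < c) (hr : 0 < r) (hR : r < R) (y z : ℝ) :
    0 ≤ bridgeCDF c r R y z :=
  integral_nonneg fun u ↦ bridgeDensity_nonneg hc.le hr.le hR.le u z

lemma bridgeCDF_le_one (hc : 0 < c) (hr : 0 < r) (hR : r < R) (hz : 0 < z) (y : ℝ) :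
    bridgeCDF c r R y z ≤ 1 := by
  rw [← integral_bridgeDensity hc hr hR hz]
  exact setIntegral_le_integral (integrable_bridgeDensity hc hr hR hz)
    (ae_of_all _ fun u ↦ bridgeDensity_nonneg hc.le hr.le hR.le u z)

lemma mul_bridgeDensity_nonneg (hc : 0 < c) (hr : 0 < r) (hR : r < R) (u z : ℝ) :
    0 ≤ u * bridgeDensity c r R u z := by
  rcases le_or_gt u 0 with hu | hu
  · rw [bridgeDensity_of_nonpos _ _ _ _ hu, mul_zero]
  · exact mul_nonneg hu.le (bridgeDensity_nonneg hc.le hr.le hR.le u z)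

lemma bridgeMoment_nonneg (hc : 0 < c) (hr : 0 < r) (hR : r < R) (hy : 0 ≤ y) (z : ℝ) :
    0 ≤ bridgeMoment c r R y z := by
  rw [bridgeMoment_eq_setIntegral c r R z hy]
  exact integral_nonneg fun u ↦ mul_bridgeDensity_nonneg hc hr hR u z

lemma bridgeMoment_le (hc : 0 < c) (hr : 0 < r) (hR : r < R) (hz : 0 < z) (hy : 0 ≤ y) :
    bridgeMoment c r R y z ≤ r / R * z := by
  rw [bridgeMoment_eq_setIntegral c r R z hy, ← integral_mul_bridgeDensity hc hr hR hz]
  exact setIntegral_le_integral (integrable_mul_bridgeDensity hc hr hR hz)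
    (ae_of_all _ fun u ↦ mul_bridgeDensity_nonneg hc hr hR u z)

lemma measurable_bridgeCDF (c r R y : ℝ) : Measurable (bridgeCDF c r R y) := by
  unfold bridgeCDF
  have : StronglyMeasurable fun p : ℝ × ℝ ↦ bridgeDensity c r R p.2 p.1 :=
    ((measurable_bridgeDensity c r R).comp measurable_swap).stronglyMeasurable
  exact this.integral_prod_right.measurable

lemma measurable_bridgeMoment (c r R : ℝ) (hy : 0 ≤ y) : Measurable (bridgeMoment c r R y) := by
  have : StronglyMeasurable fun p : ℝ × ℝ ↦ p.2 * bridgeDensity c r R p.2 p.1 :=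
    (measurable_snd.mul
      ((measurable_bridgeDensity c r R).comp measurable_swap)).stronglyMeasurable
  simp_rw [funext fun z ↦ bridgeMoment_eq_setIntegral c r R z hy]
  exact this.integral_prod_right.measurable

/-- The expected exceedance over `k` of a bridge started at `0`. -/
lemma integral_max_mul_bridgeDensity (hc : 0 < c) (hr : 0 < r) (hR : r < R) (hz : 0 < z)
    (k : ℝ) :
    Integrable (fun u ↦ max (u - k) 0 * bridgeDensity c r R u z) ∧
      ∫ u, max (u - k) 0 * bridgeDensity c r R u z = r / R * z - k +
        if 0 < k then k * bridgeCDF c r R k z - bridgeMoment c r R k z else 0 := by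
  have h1 := integrable_bridgeDensity hc hr hR hz
  have h2 := integrable_mul_bridgeDensity hc hr hR hz
  have h3 : Integrable fun u ↦ (u - k) * bridgeDensity c r R u z := by
    simp_rw [sub_mul]
    exact h2.sub (h1.const_mul k)
  have h4 : ∫ u, (u - k) * bridgeDensity c r R u z = r / R * z - k := by
    simp_rw [sub_mul]
    rw [integral_sub h2 (h1.const_mul k), integral_const_mul, integral_bridgeDensity hc hr hR hz,
      integral_mul_bridgeDensity hc hr hR hz, mul_one]
  split_ifs with hk
  -- For `k > 0` the part of `u - k` below the strike is subtracted again, which produces `F` and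
  -- `M` at `k`.
  · have h5 : (fun u ↦ max (u - k) 0 * bridgeDensity c r R u z) = fun u ↦
        (u - k) * bridgeDensity c r R u z -
          (Iic k).indicator (fun u ↦ (u - k) * bridgeDensity c r R u z) u := by
      funext u
      by_cases hu : u ≤ k
      · rw [indicator_of_mem (mem_Iic.2 hu), max_eq_right (by linarith)]; simp
      · rw [indicator_of_notMem (by simpa using hu), max_eq_left (by linarith [not_le.1 hu])]; simp
    rw [h5]
    have h6 := h3.indicator (measurableSet_Iic (a := k))
    refine ⟨h3.sub h6, ?_⟩
    rw [integral_sub h3 h6, integral_indicator measurableSet_Iic, h4]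
    have h7 : ∫ u in Iic k, (u - k) * bridgeDensity c r R u z =
        bridgeMoment c r R k z - k * bridgeCDF c r R k z := by
      simp_rw [sub_mul]
      rw [integral_sub h2.integrableOn (h1.const_mul k).integrableOn, integral_const_mul,
        bridgeMoment_eq_setIntegral c r R z hk.le, bridgeCDF]
    rw [h7]; ring
  -- For `k ≤ 0` the positive part is inert, because the bridge density lives on `u > 0`.
  · have h5 : (fun u ↦ max (u - k) 0 * bridgeDensity c r R u z) = fun u ↦
        (u - k) * bridgeDensity c r R u z := by
      funext u
      rcases le_or_gt u 0 with hu | hu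
      · simp [bridgeDensity_of_nonpos _ _ _ _ hu]
      · rw [max_eq_left (by linarith)]
    rw [h5, h4]
    exact ⟨h3, by ring⟩

end ClosedForms

/-! ### Joint densities of paths observed at finitely many times -/

section PathDensity

/-- The last entry of `(0, x₁, …, xₙ)`: the current value of a path observed at `n` times. -/
def lastValue {α : Type*} [Zero α] {n : ℕ} (x : Fin n → α) : α :=
  (Fin.cons 0 x : Fin (n + 1) → α) (Fin.last n)

@[simp]
lemma lastValue_snoc {α : Type*} [Zero α] {n : ℕ} (x : Fin n → α) (y : α) :
    lastValue (Fin.snoc x y : Fin (n + 1) → α) = y := by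
  rw [lastValue, Fin.cons_snoc_eq_snoc_cons, Fin.snoc_last]

/-- The value `0` on the empty tuple stands for both the time `0` and the starting point `0`, so `s
= 0` is the case `n = 0` and needs no separate argument. -/
lemma lastValue_zero {α : Type*} [Zero α] (x : Fin 0 → α) : lastValue x = 0 := rfl

lemma lastValue_succ {α : Type*} [Zero α] {n : ℕ} (x : Fin (n + 1) → α) :
    lastValue x = x (Fin.last n) := by
  rw [lastValue, ← Fin.succ_last, Fin.cons_succ]

lemma lastValue_coe {n : ℕ} (t : Fin n → ℝ≥0) :
    lastValue (fun i ↦ (t i : ℝ)) = (lastValue t : ℝ≥0) := by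
  cases n with
  | zero => simp [lastValue_zero]
  | succ n => simp [lastValue_succ]

lemma le_lastValue {n : ℕ} {t : Fin n → ℝ≥0} (ht : Monotone t) (i : Fin n) :
    t i ≤ lastValue t := by
  cases n with
  | zero => exact i.elim0
  | succ n => exact lastValue_succ t ▸ ht (Fin.le_last i)

lemma strictMono_snoc {α : Type*} [Preorder α] {n : ℕ} {t : Fin n → α} (ht : StrictMono t) {u : α}
    (hu : ∀ i, t i < u) : StrictMono (Fin.snoc t u : Fin (n + 1) → α) := by
  intro i j hij
  induction j using Fin.lastCases with
  | last =>
    induction i using Fin.lastCases with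
    | last => exact absurd hij (lt_irrefl _)
    | cast i => simpa using hu i
  | cast j =>
    induction i using Fin.lastCases with
    | last => exact absurd hij (Fin.le_last _).not_gt
    | cast i => simpa using ht (by simpa using hij)

@[fun_prop]
lemma measurable_lastValue {n : ℕ} : Measurable (lastValue : (Fin n → ℝ) → ℝ) := by
  cases n with
  | zero => exact measurable_const
  | succ n => simp_rw [funext (lastValue_succ (α := ℝ) (n := n))]; fun_prop

/-- Independence of increments: a further time contributes one factor depending only on the last
time and value. It serves to split off the terminal time as well as an intermediate one. -/
lemma jointDensity_snoc (c : ℝ) {n : ℕ} (t x : Fin n → ℝ) (T z : ℝ) :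
    jointDensity c (Fin.snoc t T : Fin (n + 1) → ℝ) (Fin.snoc x z : Fin (n + 1) → ℝ) =
      jointDensity c t x * stableDensity c (T - lastValue t) (z - lastValue x) := by
  simp only [jointDensity, Fin.prod_univ_castSucc, Fin.cons_snoc_eq_snoc_cons, Fin.snoc_castSucc,
    Fin.snoc_last, lastValue]

lemma measurable_jointDensity (c : ℝ) {n : ℕ} (t : Fin n → ℝ) : Measurable (jointDensity c t) := by
  have h : ∀ j : Fin (n + 1), Measurable fun x : Fin n → ℝ ↦ (Fin.cons 0 x : Fin (n + 1) → ℝ) j := by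
    intro j
    induction j using Fin.cases with
    | zero => exact measurable_const
    | succ i => simpa using measurable_pi_apply i
  unfold jointDensity
  exact Finset.measurable_prod _ fun i _ ↦
    (measurable_stableDensity c _).comp ((measurable_pi_apply i).sub (h _))

lemma jointDensity_nonneg {c : ℝ} (hc : 0 ≤ c) {n : ℕ} {t : Fin n → ℝ} (ht : Monotone t)
    (ht0 : ∀ i, 0 ≤ t i) (x : Fin n → ℝ) : 0 ≤ jointDensity c t x := by
  refine Finset.prod_nonneg fun i _ ↦ stableDensity_nonneg hc (sub_nonneg.2 ?_) _
  obtain _ | n := n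
  · exact i.elim0
  induction i using Fin.cases with
  | zero => exact ht0 0
  | succ j =>
    rw [← Fin.succ_castSucc, Fin.cons_succ]
    exact ht (Fin.castSucc_lt_succ).le

/-- Integration over `ℝⁿ⁺¹` as iterated integration over the first `n` coordinates and the last. -/
lemma lintegral_fin_snoc {n : ℕ} {G : (Fin (n + 1) → ℝ) → ℝ≥0∞} (hG : Measurable G) :
    ∫⁻ x, G x = ∫⁻ x : Fin n → ℝ, ∫⁻ y : ℝ, G (Fin.snoc x y : Fin (n + 1) → ℝ) := by
  have h := (volume_preserving_piFinSuccAbove (fun _ : Fin (n + 1) ↦ ℝ) (Fin.last n)).symm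
  rw [← h.lintegral_comp hG, Measure.volume_eq_prod]
  refine (lintegral_prod_symm _ (hG.comp (MeasurableEquiv.measurable _)).aemeasurable).trans ?_
  simp [MeasurableEquiv.piFinSuccAbove, Fin.insertNthEquiv, Fin.insertNth_last']

end PathDensity

/-! ### The posterior law and the Chapman-Kolmogorov identity -/

section Posterior

variable {c T s : ℝ} {ν : Measure ℝ}

lemma measurable_psi_density (c T s : ℝ) : Measurable fun p : ℝ × ℝ ↦
    ENNReal.ofReal (stableDensity c (T - s) (p.2 - p.1) / stableDensity c T p.2) := by
  fun_prop

lemma lintegral_psi (c T s x : ℝ) (ν : Measure ℝ) {f : ℝ → ℝ≥0∞} (hf : Measurable f) :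
    ∫⁻ z, f z ∂psi c T ν s x = ∫⁻ z,
      ENNReal.ofReal (stableDensity c (T - s) (z - x) / stableDensity c T z) * f z ∂ν :=
  lintegral_withDensity_eq_lintegral_mul _ (by fun_prop) hf

lemma lintegral_posterior (c T s x : ℝ) (ν : Measure ℝ) (f : ℝ → ℝ≥0∞) :
    ∫⁻ z, f z ∂posterior c T ν s x = (psi c T ν s x univ)⁻¹ * ∫⁻ z, f z ∂psi c T ν s x := by
  rw [posterior, lintegral_smul_measure, smul_eq_mul]

lemma measurable_lintegral_psi [SFinite ν] (c T s : ℝ) {f : ℝ → ℝ → ℝ≥0∞}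
    (hf : Measurable (Function.uncurry f)) :
    Measurable fun x ↦ ∫⁻ z, f x z ∂psi c T ν s x := by
  simp_rw [fun x ↦ lintegral_psi c T s x ν (f := f x) (hf.comp measurable_prodMk_left)]
  exact Measurable.lintegral_prod_right' (f := fun p : ℝ × ℝ ↦
    ENNReal.ofReal (stableDensity c (T - s) (p.2 - p.1) / stableDensity c T p.2) * f p.1 p.2)
    ((measurable_psi_density c T s).mul hf)

lemma measurable_psi_univ [SFinite ν] (c T s : ℝ) : Measurable fun x ↦ psi c T ν s x univ := by
  simpa using measurable_lintegral_psi (ν := ν) c T s (f := fun _ _ ↦ 1) measurable_const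

lemma measurable_lintegral_posterior [SFinite ν] (c T s : ℝ) {f : ℝ → ℝ → ℝ≥0∞}
    (hf : Measurable (Function.uncurry f)) :
    Measurable fun x ↦ ∫⁻ z, f x z ∂posterior c T ν s x := by
  simp_rw [lintegral_posterior]
  exact (measurable_psi_univ c T s).inv.mul (measurable_lintegral_psi c T s hf)

/-- Undoes the normalisation. A vanishing mass does no harm, since the measure itself is then `0`;
infinite mass must be excluded because its inverse is `0`. -/
lemma psi_univ_mul_lintegral_posterior {x : ℝ} (h : psi c T ν s x univ ≠ ∞) (f : ℝ → ℝ≥0∞) :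
    psi c T ν s x univ * ∫⁻ z, f z ∂posterior c T ν s x = ∫⁻ z, f z ∂psi c T ν s x := by
  rw [lintegral_posterior, ← mul_assoc]
  by_cases h0 : psi c T ν s x univ = 0
  · simp [Measure.measure_univ_eq_zero.1 h0]
  · rw [ENNReal.mul_inv_cancel h0 h, one_mul]

lemma posterior_absolutelyContinuous (c T s x : ℝ) (ν : Measure ℝ) :
    posterior c T ν s x ≪ ν :=
  Measure.smul_absolutelyContinuous.trans (withDensity_absolutelyContinuous _ _)

lemma ae_lt_posterior (c T s x : ℝ) (ν : Measure ℝ) : ∀ᵐ z ∂posterior c T ν s x, x < z := by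
  refine Measure.smul_absolutelyContinuous.ae_le ?_
  change ∀ᵐ z ∂psi c T ν s x, x < z
  rw [psi, ae_withDensity_iff (by fun_prop)]
  refine ae_of_all _ fun z hz ↦ ?_
  by_contra h
  exact hz (by simp [stableDensity_of_nonpos _ _ (sub_nonpos.2 (not_lt.1 h))])

/-- The average of `φ(·, z)` over the time-`u` value of the bridge that is at `x` at time `s` and at
`z` at time `T`; here `r = u - s` and `R = T - s`. -/
noncomputable def bridgeAvg (c r R : ℝ) (φ : ℝ → ℝ → ℝ≥0∞) (x z : ℝ) : ℝ≥0∞ :=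
  ∫⁻ y, φ y z * ENNReal.ofReal (bridgeDensity c r R (y - x) (z - x))

lemma measurable_bridgeAvg (c r R : ℝ) {φ : ℝ → ℝ → ℝ≥0∞} (hφ : Measurable (Function.uncurry φ)) :
    Measurable (Function.uncurry (bridgeAvg c r R φ)) := by
  refine Measurable.lintegral_prod_right' (f := fun p : (ℝ × ℝ) × ℝ ↦
    φ p.2 p.1.2 * ENNReal.ofReal (bridgeDensity c r R (p.2 - p.1.1) (p.1.2 - p.1.1)))
    ((hφ.comp (measurable_snd.prodMk (measurable_snd.comp measurable_fst))).mul
      (((measurable_bridgeDensity c r R).comp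
        (f := fun p : (ℝ × ℝ) × ℝ ↦ (p.2 - p.1.1, p.1.2 - p.1.1)) (by fun_prop)).ennreal_ofReal))

/-- Multiplying and dividing by `f_{T-s}(z - x)` is legitimate for `z > x`. For `z ≤ x` both sides
vanish: either `y ≤ x` kills the step from `x` to `y`, or `z ≤ x < y` kills the step from `y` to
`z`. -/
lemma stableDensity_mul_stableDensity (c s u T x y z : ℝ) (hc : 0 < c) (hsT : s < T) :
    stableDensity c (u - s) (y - x) * (stableDensity c (T - u) (z - y) / stableDensity c T z) =
      stableDensity c (T - s) (z - x) / stableDensity c T z *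
        bridgeDensity c (u - s) (T - s) (y - x) (z - x) := by
  rw [bridgeDensity, show T - s - (u - s) = T - u by ring, show z - x - (y - x) = z - y by ring]
  rcases le_or_gt z x with h | h
  · rw [stableDensity_of_nonpos c (T - s) (sub_nonpos.2 h)]
    rcases le_or_gt y x with h' | h'
    · simp [stableDensity_of_nonpos _ _ (sub_nonpos.2 h')]
    · simp [stableDensity_of_nonpos _ _ (sub_nonpos.2 (h.trans h'.le))]
  · have := (stableDensity_pos hc (sub_pos.2 hsT) (sub_pos.2 h)).ne'
    field_simp

/-- Chapman-Kolmogorov: integrating the transition of the unnormalised terminal measure from `s` to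
`u` gives back the bridge averages under the unnormalised terminal measure at `s`. -/
lemma lintegral_stableDensity_mul_lintegral_psi [SFinite ν] {u : ℝ} (hc : 0 < c) (hsu : s ≤ u)
    (huT : u < T) (hT : 0 ≤ T) (x : ℝ) {φ : ℝ → ℝ → ℝ≥0∞} (hφ : Measurable (Function.uncurry φ)) :
    ∫⁻ y, ENNReal.ofReal (stableDensity c (u - s) (y - x)) * ∫⁻ z, φ y z ∂psi c T ν u y =
      ∫⁻ z, bridgeAvg c (u - s) (T - s) φ x z ∂psi c T ν s x := by
  have hsT : s < T := hsu.trans_lt huT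
  have hφ1 : ∀ y, Measurable (φ y) := fun y ↦ hφ.comp measurable_prodMk_left
  have hφ2 : ∀ z, Measurable fun y ↦ φ y z := fun z ↦ hφ.comp measurable_prodMk_right
  have hb : ∀ z, Measurable fun y ↦ bridgeDensity c (u - s) (T - s) (y - x) (z - x) := fun z ↦
    (measurable_bridgeDensity c (u - s) (T - s)).comp (f := fun y ↦ (y - x, z - x)) (by fun_prop)
  have hA : Measurable (bridgeAvg c (u - s) (T - s) φ x) :=
    (measurable_bridgeAvg c _ _ hφ).comp measurable_prodMk_left
  have e1 : ∀ y, ENNReal.ofReal (stableDensity c (u - s) (y - x)) * ∫⁻ z, φ y z ∂psi c T ν u y =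
      ∫⁻ z, ENNReal.ofReal (stableDensity c (u - s) (y - x)) *
        (ENNReal.ofReal (stableDensity c (T - u) (z - y) / stableDensity c T z) * φ y z) ∂ν := by
    intro y
    rw [lintegral_psi _ _ _ _ _ (hφ1 y)]
    exact (lintegral_const_mul _
      (((measurable_psi_density c T u).comp measurable_prodMk_left).mul (hφ1 y))).symm
  have e2 : ∀ z, ENNReal.ofReal (stableDensity c (T - s) (z - x) / stableDensity c T z) *
      bridgeAvg c (u - s) (T - s) φ x z =
      ∫⁻ y, ENNReal.ofReal (stableDensity c (T - s) (z - x) / stableDensity c T z) *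
        (φ y z * ENNReal.ofReal (bridgeDensity c (u - s) (T - s) (y - x) (z - x))) := fun z ↦
    (lintegral_const_mul _ ((hφ2 z).mul (hb z).ennreal_ofReal)).symm
  rw [lintegral_psi _ _ _ _ _ hA, lintegral_congr e1, lintegral_congr e2, lintegral_lintegral_swap]
  · refine lintegral_congr fun z ↦ lintegral_congr fun y ↦ ?_
    have h1 := stableDensity_nonneg hc.le (sub_nonneg.2 hsu) (y - x)
    have h2 : 0 ≤ stableDensity c (T - s) (z - x) / stableDensity c T z :=
      div_nonneg (stableDensity_nonneg hc.le (by linarith) _) (stableDensity_nonneg hc.le hT _)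
    rw [← mul_assoc, ← ENNReal.ofReal_mul h1, stableDensity_mul_stableDensity c s u T x y z hc hsT,
      ENNReal.ofReal_mul h2]
    ring
  · refine Measurable.aemeasurable ?_
    have h3 : Measurable fun p : ℝ × ℝ ↦ ENNReal.ofReal (stableDensity c (u - s) (p.1 - x)) := by
      fun_prop
    exact h3.mul ((measurable_psi_density c T u).mul hφ)

end Posterior

/-! ### From finite-dimensional laws to the whole past -/

section Law

variable {Ω : Type*} [MeasurableSpace Ω] {Q : Measure Ω} [IsProbabilityMeasure Q] {c : ℝ} {T : ℝ≥0}
  {ν : Measure ℝ} {ξ : ℝ≥0 → Ω → ℝ}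

/-- A finite measure on `ℝⁿ` is determined by its values at rational orthants. -/
lemma measure_ext_of_orthant {n : ℕ} {μ₁ μ₂ : Measure (Fin n → ℝ)} [IsFiniteMeasure μ₁]
    (h : ∀ q : Fin n → ℚ, μ₁ {y | ∀ i, y i ≤ q i} = μ₂ {y | ∀ i, y i ≤ q i}) : μ₁ = μ₂ := by
  have hspan : IsCountablySpanning (⋃ a : ℚ, {Iic (a : ℝ)}) := by
    refine ⟨fun n : ℕ ↦ Iic ((n : ℚ) : ℝ), fun n ↦ mem_iUnion.2 ⟨n, rfl⟩, ?_⟩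
    refine eq_univ_of_forall fun x ↦ ?_
    obtain ⟨n, hn⟩ := exists_nat_ge x
    exact mem_iUnion.2 ⟨n, by simpa using hn⟩
  have hgen : MeasurableSpace.generateFrom (pi univ '' pi univ fun _ : Fin n ↦ ⋃ a : ℚ, {Iic (a : ℝ)}) =
      MeasurableSpace.pi :=
    generateFrom_eq_pi (fun _ ↦ by
      rw [← Real.borel_eq_generateFrom_Iic_rat]; exact (BorelSpace.measurable_eq).symm)
      fun _ ↦ hspan
  have hpi : IsPiSystem (pi univ '' pi univ fun _ : Fin n ↦ ⋃ a : ℚ, {Iic (a : ℝ)}) :=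
    IsPiSystem.pi fun _ ↦ Real.isPiSystem_Iic_rat
  have horth : ∀ q : Fin n → ℚ, {y : Fin n → ℝ | ∀ i, y i ≤ q i} =
      pi univ fun i ↦ Iic (q i : ℝ) := fun q ↦ by ext; simp only [mem_ofPred_eq, Set.mem_pi, mem_univ, mem_Iic, true_imp_iff]
  -- Finiteness on the exhausting orthants is needed for `μ₁` only, so a bridge law need not be
  -- known to be finite beforehand.
  refine Measure.ext_of_generateFrom_of_iUnion _ (fun k : ℕ ↦ pi univ fun _ ↦ Iic ((k : ℚ) : ℝ))
    hgen.symm hpi ?_ (fun k ↦ ?_) (fun k ↦ measure_ne_top _ _) ?_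
  · refine eq_univ_of_forall fun x ↦ ?_
    obtain ⟨k, hk⟩ := exists_nat_ge (∑ i, |x i|)
    refine mem_iUnion.2 ⟨k, fun i _ ↦ ?_⟩
    simp only [mem_Iic, Rat.cast_natCast]
    exact ((le_abs_self _).trans
      (Finset.single_le_sum (f := fun i ↦ |x i|) (fun i _ ↦ abs_nonneg _) (Finset.mem_univ i))).trans
      hk
  · exact ⟨_, fun i _ ↦ mem_iUnion.2 ⟨k, rfl⟩, rfl⟩
  · rintro _ ⟨S, hS, rfl⟩
    have : ∀ i, ∃ a : ℚ, S i = Iic (a : ℝ) := fun i ↦ by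
      simpa [eq_comm] using hS i (mem_univ i)
    choose q hq using this
    rw [show S = fun i ↦ Iic (q i : ℝ) from funext hq, ← horth]
    exact h q

/-- The exceptional null set in the defining property depends on the orthant; restricting to the
countably many rational orthants gives a common one. -/
lemma IsStableHalfRandomBridge.condDistrib_eq (hξ : IsStableHalfRandomBridge Q c T ν ξ) {n : ℕ}
    {t : Fin n → ℝ≥0} (ht : StrictMono t) (ht' : ∀ i, 0 < t i ∧ t i < T) :
    ∀ᵐ z ∂ν, condDistrib (fun ω i ↦ ξ (t i) ω) (ξ T) Q z = bridgeLaw c T (fun i ↦ (t i : ℝ)) z := by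
  have h := ae_all_iff.2 fun q : Fin n → ℚ ↦ hξ.bridge_law n t ht ht' fun i ↦ (q i : ℝ)
  filter_upwards [h] with z hz
  exact measure_ext_of_orthant hz

/-- The joint law of the values of the bridge at times `t₁ < ⋯ < tₙ` and at time `T`. -/
lemma IsStableHalfRandomBridge.lintegral_path (hξ : IsStableHalfRandomBridge Q c T ν ξ) (hc : 0 ≤ c)
    {n : ℕ} {t : Fin n → ℝ≥0} (ht : StrictMono t) (ht' : ∀ i, 0 < t i ∧ t i < T)
    {F : (Fin n → ℝ) → ℝ → ℝ≥0∞} (hF : Measurable (Function.uncurry F)) :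
    ∫⁻ ω, F (fun i ↦ ξ (t i) ω) (ξ T ω) ∂Q =
      ∫⁻ x, ENNReal.ofReal (jointDensity c (fun i ↦ (t i : ℝ)) x) *
        ∫⁻ z, F x z ∂psi c T ν (lastValue fun i ↦ (t i : ℝ)) (lastValue x) := by
  have hm : ∀ u, Measurable (ξ u) := fun u ↦ (hξ.stronglyMeasurable u).measurable
  have hv : Measurable fun ω (i : Fin n) ↦ ξ (t i) ω := measurable_pi_lambda _ fun i ↦ hm _
  have hν : IsProbabilityMeasure ν := hξ.terminal_law ▸ Measure.isProbabilityMeasure_map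
    (hm T).aemeasurable
  have hFx : ∀ x, Measurable (F x) := fun x ↦ hF.comp measurable_prodMk_left
  have hj := measurable_jointDensity c fun i ↦ (t i : ℝ)
  have hj2 : ∀ z : ℝ, Measurable fun x : Fin n → ℝ ↦ ENNReal.ofReal
      (jointDensity c (Fin.snoc (fun i ↦ (t i : ℝ)) T : Fin (n + 1) → ℝ)
        (Fin.snoc x z : Fin (n + 1) → ℝ) / stableDensity c T z) := fun z ↦ by
    simp_rw [jointDensity_snoc]
    fun_prop
  calc ∫⁻ ω, F (fun i ↦ ξ (t i) ω) (ξ T ω) ∂Q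
      = ∫⁻ p, F p.2 p.1 ∂(Q.map fun ω ↦ (ξ T ω, fun i ↦ ξ (t i) ω)) :=
        (lintegral_map (hF.comp measurable_swap) ((hm T).prodMk hv)).symm
    _ = ∫⁻ z, ∫⁻ x, F x z ∂condDistrib (fun ω i ↦ ξ (t i) ω) (ξ T) Q z ∂ν := by
        rw [← compProd_map_condDistrib hv.aemeasurable, hξ.terminal_law]
        exact Measure.lintegral_compProd (hF.comp measurable_swap)
    _ = ∫⁻ z, ∫⁻ x : Fin n → ℝ, ENNReal.ofReal (jointDensity c (fun i ↦ (t i : ℝ)) x) *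
          (ENNReal.ofReal (stableDensity c (T - lastValue fun i ↦ (t i : ℝ)) (z - lastValue x) /
            stableDensity c T z) * F x z) ∂volume ∂ν := by
        refine lintegral_congr_ae ?_
        filter_upwards [hξ.condDistrib_eq ht ht'] with z hz
        have hFz : Measurable fun x ↦ F x z := hF.comp measurable_prodMk_right
        rw [hz, bridgeLaw, lintegral_withDensity_eq_lintegral_mul _ (hj2 z) hFz]
        refine lintegral_congr fun x ↦ ?_
        simp only [Pi.mul_apply]
        rw [jointDensity_snoc, mul_div_assoc, ENNReal.ofReal_mul
          (jointDensity_nonneg hc (fun i j hij ↦ by simpa using ht.monotone hij) (by simp) x),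
          mul_assoc]
    _ = _ := by
        rw [lintegral_lintegral_swap]
        · refine lintegral_congr fun x ↦ ?_
          rw [lintegral_psi _ _ _ _ _ (hFx x), lintegral_const_mul]
          exact ((measurable_psi_density _ _ _).comp measurable_prodMk_left).mul (hFx x)
        · refine Measurable.aemeasurable ?_
          have h1 : Measurable fun p : ℝ × (Fin n → ℝ) ↦
              ENNReal.ofReal (jointDensity c (fun i ↦ (t i : ℝ)) p.2) :=
            (hj.comp measurable_snd).ennreal_ofReal
          have h2 := (measurable_psi_density c T (lastValue fun i ↦ (t i : ℝ))).comp
            (f := fun p : ℝ × (Fin n → ℝ) ↦ (lastValue p.2, p.1)) (by fun_prop)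
          exact h1.mul (h2.mul (hF.comp measurable_swap))

/-- The Markov-type identity on a cylinder set. -/
lemma IsStableHalfRandomBridge.lintegral_cylinder (hξ : IsStableHalfRandomBridge Q c T ν ξ)
    (hc : 0 < c) {n : ℕ} {t : Fin n → ℝ≥0} (ht : StrictMono t) (ht0 : ∀ i, 0 < t i) {s u : ℝ≥0}
    (hs : lastValue t = s) (hsu : s < u) (huT : u < T) {C : Set (Fin n → ℝ)}
    (hC : MeasurableSet C) {φ : ℝ → ℝ → ℝ≥0∞} (hφ : Measurable (Function.uncurry φ)) :
    ∫⁻ ω in {ω | (fun i ↦ ξ (t i) ω) ∈ C}, φ (ξ u ω) (ξ T ω) ∂Q =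
      ∫⁻ ω in {ω | (fun i ↦ ξ (t i) ω) ∈ C},
        ∫⁻ z, bridgeAvg c (u - s) (T - s) φ (lastValue fun i ↦ ξ (t i) ω) z
          ∂posterior c T ν s (lastValue fun i ↦ ξ (t i) ω) ∂Q := by
  have hm : ∀ u, Measurable (ξ u) := fun u ↦ (hξ.stronglyMeasurable u).measurable
  have hv : Measurable fun ω (i : Fin n) ↦ ξ (t i) ω := measurable_pi_lambda _ fun i ↦ hm _
  have hν : IsProbabilityMeasure ν := hξ.terminal_law ▸ Measure.isProbabilityMeasure_map
    (hm T).aemeasurable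
  have hts : ∀ i, t i ≤ s := fun i ↦ hs ▸ le_lastValue ht.monotone i
  have htT : ∀ i, 0 < t i ∧ t i < T := fun i ↦ ⟨ht0 i, (hts i).trans_lt (hsu.trans huT)⟩
  have ht1 : StrictMono (Fin.snoc t u : Fin (n + 1) → ℝ≥0) :=
    strictMono_snoc ht fun i ↦ (hts i).trans_lt hsu
  have ht1T : ∀ i, 0 < (Fin.snoc t u : Fin (n + 1) → ℝ≥0) i ∧
      (Fin.snoc t u : Fin (n + 1) → ℝ≥0) i < T := by
    intro i
    induction i using Fin.lastCases with
    | last => simpa using ⟨pos_of_gt hsu, huT⟩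
    | cast i => simpa using htT i
  have hcast : (fun i ↦ ((Fin.snoc t u : Fin (n + 1) → ℝ≥0) i : ℝ)) =
      (Fin.snoc (fun i ↦ (t i : ℝ)) (u : ℝ) : Fin (n + 1) → ℝ) :=
    Fin.comp_snoc NNReal.toReal t u
  have hsR : lastValue (fun i ↦ (t i : ℝ)) = s := by rw [← hs, lastValue_coe]
  have hsuR : (s : ℝ) ≤ u := by exact_mod_cast hsu.le
  have huTR : (u : ℝ) < T := by exact_mod_cast huT
  set Ψ : ℝ → ℝ≥0∞ := fun x ↦ ∫⁻ z, bridgeAvg c (u - s) (T - s) φ x z ∂posterior c T ν s x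
  have hΨm : Measurable Ψ := measurable_lintegral_posterior c T s (measurable_bridgeAvg c _ _ hφ)
  have hCv : MeasurableSet {ω | (fun i ↦ ξ (t i) ω) ∈ C} := hv hC
  set g : (Fin n → ℝ) → ℝ≥0∞ := fun x ↦
    ENNReal.ofReal (jointDensity c (fun i ↦ (t i : ℝ)) x)
  have hgm : Measurable g := (measurable_jointDensity c _).ennreal_ofReal
  have hC1 : Measurable (C.indicator (1 : (Fin n → ℝ) → ℝ≥0∞)) := measurable_one.indicator hC
  -- Testing the joint law with `F = 1` shows that `g · ψ_s(ℝ)` has integral `1`, hence is finite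
  -- almost everywhere; so `ψ_s(ℝ)` is finite wherever `g` is nonzero, and normalisation can be
  -- undone there.
  have hfin : ∀ᵐ x, g x * psi c T ν s (lastValue x) univ < ∞ := by
    refine ae_lt_top (hgm.mul ((measurable_psi_univ c T s).comp measurable_lastValue)) ?_
    have := hξ.lintegral_path hc.le ht htT (F := fun _ _ ↦ 1) measurable_const
    simp only [lintegral_const, measure_univ, mul_one, one_mul, hsR] at this
    rw [← this]
    exact ENNReal.one_ne_top
  -- Time `u` is appended to the path, and its value is integrated out by Chapman-Kolmogorov.
  have hL : ∫⁻ ω in {ω | (fun i ↦ ξ (t i) ω) ∈ C}, φ (ξ u ω) (ξ T ω) ∂Q =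
      ∫⁻ x, g x * (C.indicator 1 x *
        ∫⁻ z, bridgeAvg c (u - s) (T - s) φ (lastValue x) z ∂psi c T ν s (lastValue x)) := by
    have h1 := hξ.lintegral_path hc.le ht1 ht1T
      (F := fun x z ↦ C.indicator 1 (Fin.init x) * φ (x (Fin.last n)) z)
      ((hC1.comp (f := fun p : (Fin (n + 1) → ℝ) × ℝ ↦ (Fin.init p.1 : Fin n → ℝ))
        (measurable_pi_lambda _ fun i ↦ (measurable_pi_apply _).comp measurable_fst)).mul
        (hφ.comp (f := fun p : (Fin (n + 1) → ℝ) × ℝ ↦ (p.1 (Fin.last n), p.2)) (by fun_prop)))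
    rw [← lintegral_indicator hCv]
    refine (lintegral_congr fun ω ↦ ?_).trans (h1.trans ?_)
    · have : (Fin.init fun i ↦ ξ ((Fin.snoc t u : Fin (n + 1) → ℝ≥0) i) ω : Fin n → ℝ) =
          fun i ↦ ξ (t i) ω := by
        funext i; simp [Fin.init]
      rw [this]
      by_cases hω : (fun i ↦ ξ (t i) ω) ∈ C <;> simp [hω, indicator]
    · have hpsi : Measurable fun y ↦ ∫⁻ z, φ y z ∂psi c T ν u y :=
        measurable_lintegral_psi c T u hφ
      rw [hcast, lintegral_fin_snoc]
      · refine lintegral_congr fun x ↦ ?_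
        rw [← lintegral_stableDensity_mul_lintegral_psi hc hsuR huTR (by positivity) _ hφ,
          ← lintegral_const_mul _ (by fun_prop), ← lintegral_const_mul _ (by fun_prop)]
        refine lintegral_congr fun y ↦ ?_
        have hφy : Measurable (φ y) := hφ.comp measurable_prodMk_left
        rw [jointDensity_snoc, hsR, lastValue_snoc, lastValue_snoc, Fin.init_snoc, Fin.snoc_last,
          lintegral_const_mul _ hφy,
          ENNReal.ofReal_mul (jointDensity_nonneg hc.le
            (fun i j hij ↦ by simpa using ht.monotone hij) (by simp) x)]
        ring
      · refine (measurable_jointDensity c _).ennreal_ofReal.mul ?_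
        have h2 : ∀ x : Fin (n + 1) → ℝ,
            ∫⁻ z, C.indicator 1 (Fin.init x) * φ (x (Fin.last n)) z ∂psi c T ν u (x (Fin.last n)) =
            C.indicator 1 (Fin.init x) *
              ∫⁻ z, φ (x (Fin.last n)) z ∂psi c T ν u (x (Fin.last n)) := fun x ↦
          lintegral_const_mul _ (hφ.comp measurable_prodMk_left)
        simp_rw [lastValue_snoc, lastValue_succ, h2]
        exact (hC1.comp (f := fun x : Fin (n + 1) → ℝ ↦ (Fin.init x : Fin n → ℝ))
          (measurable_pi_lambda _ fun i ↦ measurable_pi_apply _)).mul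
          (hpsi.comp (measurable_pi_apply _))
  -- Here the integrand does not involve the terminal value, so integrating `z` out leaves the mass
  -- `ψ_s(ℝ)`.
  have hR : ∫⁻ ω in {ω | (fun i ↦ ξ (t i) ω) ∈ C}, Ψ (lastValue fun i ↦ ξ (t i) ω) ∂Q =
      ∫⁻ x, g x * ((C.indicator 1 x * Ψ (lastValue x)) * psi c T ν s (lastValue x) univ) := by
    have h1 := hξ.lintegral_path hc.le ht htT
      (F := fun x _ ↦ C.indicator 1 x * Ψ (lastValue x)) (by fun_prop)
    simp only [lintegral_const, hsR] at h1
    rw [← lintegral_indicator hCv, ← h1]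
    refine lintegral_congr fun ω ↦ ?_
    by_cases hω : (fun i ↦ ξ (t i) ω) ∈ C <;> simp [hω, indicator]
  rw [hL, hR]
  refine lintegral_congr_ae ?_
  filter_upwards [hfin] with x hx
  by_cases h0 : g x = 0
  · simp [h0]
  · have hψ : psi c T ν s (lastValue x) univ ≠ ∞ := fun h ↦ by
      rw [h, ENNReal.mul_top h0] at hx
      exact hx.ne rfl
    rw [← psi_univ_mul_lintegral_posterior hψ]
    ring

/-- A set of the natural filtration at time `s` depending on finitely many times is, up to a null
set, a cylinder over finitely many positive times the last of which is `s` (no time at all if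
`s = 0`). -/
lemma IsStableHalfRandomBridge.exists_cylinder (hξ : IsStableHalfRandomBridge Q c T ν ξ)
    {s : ℝ≥0} {I : Finset ℝ≥0} (hI : ∀ u ∈ I, u ≤ s) {A : ℝ≥0 → Set ℝ}
    (hA : ∀ u ∈ I, MeasurableSet (A u)) :
    ∃ (n : ℕ) (t : Fin n → ℝ≥0) (C : Set (Fin n → ℝ)), StrictMono t ∧ (∀ i, 0 < t i) ∧
      lastValue t = s ∧ MeasurableSet C ∧
      (∀ᵐ ω ∂Q, (∀ u ∈ I, ξ u ω ∈ A u) ↔ (fun i ↦ ξ (t i) ω) ∈ C) ∧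
      ∀ᵐ ω ∂Q, (lastValue fun i ↦ ξ (t i) ω) = ξ s ω := by
  classical
  -- Adding `s` makes it the last time; removing `0` is harmless because `ξ 0 = 0` almost surely,
  -- and leaves only the positive times to which the bridge law applies.
  set J := (insert s I).erase 0 with hJ
  set t := J.orderEmbOfFin rfl with ht
  have htJ : ∀ i, t i ∈ J := fun i ↦ Finset.orderEmbOfFin_mem J rfl i
  have hlast : ∀ k (τ : Fin k → ℝ≥0), (k = 0 → s = 0) → (∀ h : 0 < k, τ ⟨k - 1, by omega⟩ = s) →
      lastValue τ = s ∧ ∀ᵐ ω ∂Q, (lastValue fun i ↦ ξ (τ i) ω) = ξ s ω := by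
    intro k τ h0 h1
    obtain _ | k := k
    · refine ⟨(h0 rfl).symm, ?_⟩
      filter_upwards [hξ.start_zero] with ω hω
      rw [h0 rfl, hω, lastValue_zero]
    · have h2 : τ (Fin.last k) = s := h1 k.succ_pos
      exact ⟨(lastValue_succ τ).trans h2, ae_of_all _ fun ω ↦ by rw [lastValue_succ, h2]⟩
  obtain ⟨hl1, hl2⟩ := hlast J.card t
    (fun h ↦ by
      by_contra hs
      have : s ∈ J := Finset.mem_erase.2 ⟨hs, Finset.mem_insert_self _ _⟩
      simp [Finset.card_eq_zero.1 h] at this)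
    (fun h ↦ by
      rw [ht, Finset.orderEmbOfFin_last rfl h]
      obtain ⟨v, hv⟩ := Finset.card_pos.1 h
      have hle : ∀ v ∈ J, v ≤ s := fun v hv ↦ by
        rcases Finset.mem_insert.1 (Finset.mem_erase.1 hv).2 with h | h
        exacts [h.le, hI v h]
      have hs : s ∈ J := Finset.mem_erase.2
        ⟨((pos_iff_ne_zero.2 (Finset.mem_erase.1 hv).1).trans_le (hle v hv)).ne',
          Finset.mem_insert_self _ _⟩
      exact le_antisymm (Finset.max'_le _ _ _ hle) (Finset.le_max' _ _ hs))
  refine ⟨J.card, t, {x | (∀ i, t i ∈ I → x i ∈ A (t i)) ∧ (0 ∈ I → (0 : ℝ) ∈ A 0)}, t.strictMono,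
    fun i ↦ pos_iff_ne_zero.2 (Finset.mem_erase.1 (htJ i)).1, hl1, ?_, ?_, hl2⟩
  · simp only [ofPred_and, ofPred_forall]
    refine MeasurableSet.inter (MeasurableSet.iInter fun i ↦ MeasurableSet.iInter fun hi ↦
      measurable_pi_apply i (hA _ hi)) (MeasurableSet.iInter fun _ ↦ MeasurableSet.const _)
  · filter_upwards [hξ.start_zero] with ω hω
    refine ⟨fun h ↦ ⟨fun i hi ↦ h _ hi, fun h0 ↦ hω ▸ h 0 h0⟩, fun h u hu ↦ ?_⟩
    by_cases hu0 : u = 0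
    · subst hu0; rw [hω]; exact h.2 hu
    · have : u ∈ J := Finset.mem_erase.2 ⟨hu0, Finset.mem_insert_of_mem hu⟩
      obtain ⟨i, rfl⟩ : u ∈ range t := by
        rw [ht, Finset.range_orderEmbOfFin]; exact this
      exact h.1 i hu

/-- Conditionally on the past up to time `s`, the terminal value has the posterior law, and given
the terminal value the path continues as a stable-1/2 bridge. -/
lemma IsStableHalfRandomBridge.setLIntegral_eq (hξ : IsStableHalfRandomBridge Q c T ν ξ)
    (hc : 0 < c) {s u : ℝ≥0} (hsu : s < u) (huT : u < T) {φ : ℝ → ℝ → ℝ≥0∞}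
    (hφ : Measurable (Function.uncurry φ)) (hfin : ∫⁻ ω, φ (ξ u ω) (ξ T ω) ∂Q ≠ ∞) {B : Set Ω}
    (hB : MeasurableSet[Filtration.natural ξ hξ.stronglyMeasurable s] B) :
    ∫⁻ ω in B, φ (ξ u ω) (ξ T ω) ∂Q =
      ∫⁻ ω in B, ∫⁻ z, bridgeAvg c (u - s) (T - s) φ (ξ s ω) z ∂posterior c T ν s (ξ s ω) ∂Q := by
  have hle := (Filtration.natural ξ hξ.stronglyMeasurable).le s
  set π := piiUnionInter (fun v ↦ {S | MeasurableSet[MeasurableSpace.comap (ξ v) inferInstance] S})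
    (Iic s) with hπ
  have hgen : (Filtration.natural ξ hξ.stronglyMeasurable s : MeasurableSpace Ω) = MeasurableSpace.generateFrom π :=
    (generateFrom_piiUnionInter_measurableSet
      (fun v ↦ MeasurableSpace.comap (ξ v) inferInstance) (Iic s)).symm
  have key : ∀ B ∈ π, ∫⁻ ω in B, φ (ξ u ω) (ξ T ω) ∂Q =
      ∫⁻ ω in B, ∫⁻ z, bridgeAvg c (u - s) (T - s) φ (ξ s ω) z ∂posterior c T ν s (ξ s ω) ∂Q := by
    rintro _ ⟨I, hI, S, hS, rfl⟩
    choose! A hA hAS using hS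
    obtain ⟨n, t, C, ht, ht0, hts, hC, hC1, hC2⟩ := hξ.exists_cylinder (fun v hv ↦ hI hv) hA
    have hset : (⋂ v ∈ I, S v : Set Ω) =ᵐ[Q] {ω | (fun i ↦ ξ (t i) ω) ∈ C} := by
      filter_upwards [hC1] with ω hω
      refine propext (Iff.trans ?_ hω)
      change ω ∈ (⋂ v ∈ I, S v : Set Ω) ↔ _
      simp only [mem_iInter]
      refine forall₂_congr fun v hv ↦ ?_
      rw [← hAS v hv, mem_preimage]
    rw [setLIntegral_congr hset, setLIntegral_congr hset,
      hξ.lintegral_cylinder hc ht ht0 hts hsu huT hC hφ]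
    refine lintegral_congr_ae (ae_restrict_of_ae ?_)
    filter_upwards [hC2] with ω hω
    rw [hω]
  have huniv : univ ∈ π := ⟨∅, by simp, fun _ ↦ univ, by simp, by simp⟩
  have : IsFiniteMeasure (Q.withDensity fun ω ↦ φ (ξ u ω) (ξ T ω)) :=
    isFiniteMeasure_withDensity hfin
  have hBm : MeasurableSet B := hle B hB
  -- Both sides are measures on the past σ-algebra, the first finite by `hfin`; they agree on the
  -- π-system of finite intersections that generates it.
  have hext : (Q.withDensity fun ω ↦ φ (ξ u ω) (ξ T ω)).trim hle = (Q.withDensity fun ω ↦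
      ∫⁻ z, bridgeAvg c (u - s) (T - s) φ (ξ s ω) z ∂posterior c T ν s (ξ s ω)).trim hle := by
    refine ext_of_generate_finite π hgen (isPiSystem_piiUnionInter _ (fun v ↦
      @MeasurableSpace.isPiSystem_measurableSet _ (MeasurableSpace.comap (ξ v) inferInstance)) _)
      (fun B hB ↦ ?_) ?_
    · have hBm : MeasurableSet[Filtration.natural ξ hξ.stronglyMeasurable s] B := hgen ▸ MeasurableSpace.measurableSet_generateFrom hB
      rw [trim_measurableSet_eq hle hBm, trim_measurableSet_eq hle hBm,
        withDensity_apply _ (hle B hBm), withDensity_apply _ (hle B hBm), key B hB]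
    · rw [trim_measurableSet_eq hle .univ, trim_measurableSet_eq hle .univ,
        withDensity_apply _ .univ, withDensity_apply _ .univ, key univ huniv]
  have := congr($hext B)
  rwa [trim_measurableSet_eq hle hB, trim_measurableSet_eq hle hB, withDensity_apply _ hBm,
    withDensity_apply _ hBm] at this

end Law

/-- Uniqueness of conditional expectations, in terms of Lebesgue integrals. -/
lemma condExp_toReal_ae_eq {Ω : Type*} {m m₀ : MeasurableSpace Ω} {Q : Measure Ω}
    [IsFiniteMeasure Q] (hm : m ≤ m₀) {X W : Ω → ℝ≥0∞} (hX : Measurable X)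
    (hW : Measurable[m] W) (hfin : ∫⁻ ω, X ω ∂Q ≠ ∞)
    (h : ∀ B, MeasurableSet[m] B → ∫⁻ ω in B, X ω ∂Q = ∫⁻ ω in B, W ω ∂Q) :
    (∀ᵐ ω ∂Q, W ω < ∞) ∧ Q[fun ω ↦ (X ω).toReal | m] =ᵐ[Q] fun ω ↦ (W ω).toReal := by
  have hW' : Measurable W := hW.mono hm le_rfl
  have hfinW : ∫⁻ ω, W ω ∂Q ≠ ∞ := by
    have := h univ .univ
    rw [setLIntegral_univ, setLIntegral_univ] at this
    rwa [← this]
  have hWtop : ∀ᵐ ω ∂Q, W ω < ∞ := ae_lt_top hW' hfinW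
  refine ⟨hWtop, ?_⟩
  refine (ae_eq_condExp_of_forall_setIntegral_eq hm
    (integrable_toReal_of_lintegral_ne_top hX.aemeasurable hfin)
    (fun B _ _ ↦ (integrable_toReal_of_lintegral_ne_top hW'.aemeasurable hfinW).integrableOn)
    (fun B hB _ ↦ ?_) hW.ennreal_toReal.aestronglyMeasurable).symm
  rw [integral_toReal hW'.aemeasurable (ae_restrict_of_ae hWtop), integral_toReal hX.aemeasurable
    (ae_restrict_of_ae (ae_lt_top hX hfin)), h B hB]

/-! ### Evaluating bridge averages and integrating them over the posterior -/

section BridgeAvg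

variable {c r R x z : ℝ}

lemma lintegral_bridgeDensity_sub (hc : 0 < c) (hr : 0 < r) (hR : r < R) (hxz : x < z) :
    ∫⁻ y, ENNReal.ofReal (bridgeDensity c r R (y - x) (z - x)) = 1 := by
  rw [lintegral_sub_right_eq_self (fun y ↦ ENNReal.ofReal (bridgeDensity c r R y (z - x))) x,
    ← ofReal_integral_eq_lintegral_ofReal (integrable_bridgeDensity hc hr hR (sub_pos.2 hxz))
      (ae_of_all _ fun u ↦ bridgeDensity_nonneg hc.le hr.le hR.le u _),
    integral_bridgeDensity hc hr hR (sub_pos.2 hxz), ENNReal.ofReal_one]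

lemma bridgeAvg_terminal (hc : 0 < c) (hr : 0 < r) (hR : r < R) (hxz : x < z) (f : ℝ → ℝ≥0∞) :
    bridgeAvg c r R (fun _ z ↦ f z) x z = f z := by
  have hb : Measurable fun y ↦ bridgeDensity c r R (y - x) (z - x) :=
    (measurable_bridgeDensity c r R).comp (f := fun y ↦ (y - x, z - x)) (by fun_prop)
  rw [bridgeAvg, lintegral_const_mul _ hb.ennreal_ofReal, lintegral_bridgeDensity_sub hc hr hR hxz,
    mul_one]

/-- A bridge does not overshoot its terminal value. Through `setLIntegral_eq` this yields `ξ u ≤ ξ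
T` almost surely, the domination used for integrability of the payoff. -/
lemma bridgeAvg_indicator_lt (c r R x z : ℝ) :
    bridgeAvg c r R (fun y z ↦ {p : ℝ × ℝ | p.2 < p.1}.indicator 1 (y, z)) x z = 0 := by
  rw [bridgeAvg]
  refine (lintegral_congr fun y ↦ ?_).trans lintegral_zero
  by_cases h : z < y
  · rw [bridgeDensity_of_le c r R (sub_le_sub_right h.le x), ENNReal.ofReal_zero, mul_zero]
  · rw [indicator_of_notMem (by simpa using h), zero_mul]

/-- The expected exceedance over `k` of the bridge to the value `z`. -/
noncomputable def bridgeExceedance (c r R k z : ℝ) : ℝ :=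
  r / R * z - k + if 0 < k then k * bridgeCDF c r R k z - bridgeMoment c r R k z else 0

lemma bridgeExceedance_nonneg (hc : 0 < c) (hr : 0 < r) (hR : r < R) (hz : 0 < z) (k : ℝ) :
    0 ≤ bridgeExceedance c r R k z := by
  rw [bridgeExceedance, ← (integral_max_mul_bridgeDensity hc hr hR hz k).2]
  exact integral_nonneg fun u ↦
    mul_nonneg (le_max_right _ _) (bridgeDensity_nonneg hc.le hr.le hR.le u z)

lemma bridgeAvg_max_sub (hc : 0 < c) (hr : 0 < r) (hR : r < R) (hxz : x < z) (K : ℝ) :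
    bridgeAvg c r R (fun y _ ↦ ENNReal.ofReal (max (y - K) 0)) x z =
      ENNReal.ofReal (bridgeExceedance c r R (K - x) (z - x)) := by
  obtain ⟨h1, h2⟩ := integral_max_mul_bridgeDensity hc hr hR (sub_pos.2 hxz) (K - x)
  rw [bridgeExceedance, ← h2, ofReal_integral_eq_lintegral_ofReal h1
    (ae_of_all _ fun u ↦ mul_nonneg (le_max_right _ _)
      (bridgeDensity_nonneg hc.le hr.le hR.le u _)), bridgeAvg,
    ← lintegral_sub_right_eq_self (fun u ↦ ENNReal.ofReal
      (max (u - (K - x)) 0 * bridgeDensity c r R u (z - x))) x]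
  refine lintegral_congr fun y ↦ ?_
  rw [← ENNReal.ofReal_mul (le_max_right _ _), sub_sub_sub_cancel_right]

section Integrable

variable {μ : Measure ℝ} [IsFiniteMeasure μ]

lemma integrable_bridgeCDF_sub (hc : 0 < c) (hr : 0 < r) (hR : r < R) (hμ : ∀ᵐ z ∂μ, x < z)
    (k : ℝ) : Integrable (fun z ↦ bridgeCDF c r R k (z - x)) μ := by
  refine (integrable_const (1 : ℝ)).mono'
    ((measurable_bridgeCDF c r R k).comp (measurable_id.sub_const x)).aestronglyMeasurable ?_
  filter_upwards [hμ] with z hz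
  rw [Real.norm_of_nonneg (bridgeCDF_nonneg hc hr hR _ _)]
  exact bridgeCDF_le_one hc hr hR (sub_pos.2 hz) k

lemma integrable_bridgeMoment_sub (hc : 0 < c) (hr : 0 < r) (hR : r < R) (hμ : ∀ᵐ z ∂μ, x < z)
    (hint : Integrable (fun z ↦ z) μ) {k : ℝ} (hk : 0 ≤ k) :
    Integrable (fun z ↦ bridgeMoment c r R k (z - x)) μ := by
  refine ((hint.sub (integrable_const x)).const_mul (r / R)).mono'
    ((measurable_bridgeMoment c r R hk).comp (measurable_id.sub_const x)).aestronglyMeasurable ?_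
  filter_upwards [hμ] with z hz
  rw [Real.norm_of_nonneg (bridgeMoment_nonneg hc hr hR hk _)]
  exact bridgeMoment_le hc hr hR (sub_pos.2 hz) hk

lemma integrable_bridgeExceedance_sub (hc : 0 < c) (hr : 0 < r) (hR : r < R)
    (hμ : ∀ᵐ z ∂μ, x < z) (hint : Integrable (fun z ↦ z) μ) (k : ℝ) :
    Integrable (fun z ↦ bridgeExceedance c r R k (z - x)) μ := by
  unfold bridgeExceedance
  refine (((hint.sub (integrable_const x)).const_mul (r / R)).sub (integrable_const k)).add ?_
  split_ifs with hk
  · exact ((integrable_bridgeCDF_sub hc hr hR hμ k).const_mul k).sub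
      (integrable_bridgeMoment_sub hc hr hR hμ hint hk.le)
  · exact integrable_const 0

lemma integral_bridgeExceedance_sub [IsProbabilityMeasure μ] (hc : 0 < c) (hr : 0 < r) (hR : r < R)
    (hμ : ∀ᵐ z ∂μ, x < z) (hint : Integrable (fun z ↦ z) μ) (k : ℝ) :
    ∫ z, bridgeExceedance c r R k (z - x) ∂μ = r / R * (∫ z, z ∂μ - x) - k +
      if 0 < k then k * ∫ z, bridgeCDF c r R k (z - x) ∂μ - ∫ z, bridgeMoment c r R k (z - x) ∂μ
      else 0 := by
  have h1 : Integrable (fun z ↦ r / R * (z - x)) μ :=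
    (hint.sub (integrable_const x)).const_mul (r / R)
  have h2 : ∫ z, (r / R * (z - x) - k) ∂μ = r / R * (∫ z, z ∂μ - x) - k := by
    rw [integral_sub h1 (integrable_const k), integral_const_mul, integral_sub hint
      (integrable_const x)]
    simp
  unfold bridgeExceedance
  split_ifs with hk
  · have h3 := (integrable_bridgeCDF_sub hc hr hR hμ k).const_mul k
    have h4 := integrable_bridgeMoment_sub hc hr hR hμ hint hk.le
    refine (integral_add (h1.sub (integrable_const k)) (h3.sub h4)).trans ?_
    rw [← integral_const_mul, ← integral_sub h3 h4, ← h2]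
    rfl
  · simp only [add_zero, h2]

end Integrable

end BridgeAvg

/-! ### Conditional expectations given the past -/

section CondExp

variable {Ω : Type*} [MeasurableSpace Ω] {Q : Measure Ω} [IsProbabilityMeasure Q] {c : ℝ} {T : ℝ≥0}
  {ν : Measure ℝ} {ξ : ℝ≥0 → Ω → ℝ} {s u : ℝ≥0}

lemma IsStableHalfRandomBridge.condExp_ae_eq (hξ : IsStableHalfRandomBridge Q c T ν ξ)
    (hc : 0 < c) (hsu : s < u) (huT : u < T) {φ : ℝ → ℝ → ℝ≥0∞}
    (hφ : Measurable (Function.uncurry φ)) (hfin : ∫⁻ ω, φ (ξ u ω) (ξ T ω) ∂Q ≠ ∞) :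
    (∀ᵐ ω ∂Q, ∫⁻ z, bridgeAvg c (u - s) (T - s) φ (ξ s ω) z ∂posterior c T ν s (ξ s ω) < ∞) ∧
    Q[fun ω ↦ (φ (ξ u ω) (ξ T ω)).toReal | Filtration.natural ξ hξ.stronglyMeasurable s] =ᵐ[Q]
      fun ω ↦ (∫⁻ z, bridgeAvg c (u - s) (T - s) φ (ξ s ω) z
        ∂posterior c T ν s (ξ s ω)).toReal := by
  have hm : ∀ u, Measurable (ξ u) := fun u ↦ (hξ.stronglyMeasurable u).measurable
  have hν : IsProbabilityMeasure ν := hξ.terminal_law ▸ Measure.isProbabilityMeasure_map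
    (hm T).aemeasurable
  have hms : Measurable[Filtration.natural ξ hξ.stronglyMeasurable s] (ξ s) :=
    (comap_measurable (ξ s)).mono (le_iSup₂_of_le s le_rfl le_rfl) le_rfl
  exact condExp_toReal_ae_eq (Filtration.le _ s) (hφ.comp ((hm u).prodMk (hm T)))
    ((measurable_lintegral_posterior c T s (measurable_bridgeAvg c _ _ hφ)).comp hms) hfin
    fun B hB ↦ hξ.setLIntegral_eq hc hsu huT hφ hfin hB

/-- The time `u` is auxiliary: a function of `z` alone is unchanged by averaging over a bridge
density of mass one. -/
lemma IsStableHalfRandomBridge.condExp_terminal_ae_eq (hξ : IsStableHalfRandomBridge Q c T ν ξ)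
    (hc : 0 < c) (hsu : s < u) (huT : u < T) {f : ℝ → ℝ≥0∞} (hf : Measurable f)
    (hfin : ∫⁻ ω, f (ξ T ω) ∂Q ≠ ∞) :
    (∀ᵐ ω ∂Q, ∫⁻ z, f z ∂posterior c T ν s (ξ s ω) < ∞) ∧
    Q[fun ω ↦ (f (ξ T ω)).toReal | Filtration.natural ξ hξ.stronglyMeasurable s] =ᵐ[Q]
      fun ω ↦ (∫⁻ z, f z ∂posterior c T ν s (ξ s ω)).toReal := by
  have hr : (0 : ℝ) < u - s := sub_pos.2 (by exact_mod_cast hsu)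
  have hR : (u : ℝ) - s < T - s := sub_lt_sub_right (by exact_mod_cast huT) _
  have h : ∀ x, ∫⁻ z, bridgeAvg c (u - s) (T - s) (fun _ z ↦ f z) x z ∂posterior c T ν s x =
      ∫⁻ z, f z ∂posterior c T ν s x := fun x ↦ by
    refine lintegral_congr_ae ?_
    filter_upwards [ae_lt_posterior c T s x ν] with z hz
    exact bridgeAvg_terminal hc hr hR hz f
  simpa only [h] using
    hξ.condExp_ae_eq hc hsu huT (φ := fun _ z ↦ f z) (hf.comp measurable_snd) hfin

lemma IsStableHalfRandomBridge.condExp_indicator_ae_eq (hξ : IsStableHalfRandomBridge Q c T ν ξ)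
    (hc : 0 < c) (hsu : s < u) (huT : u < T) {A : Set ℝ} (hA : MeasurableSet A) :
    Q⟦ξ T ⁻¹' A | Filtration.natural ξ hξ.stronglyMeasurable s⟧ =ᵐ[Q]
      fun ω ↦ (posterior c T ν s (ξ s ω)).real A := by
  have h := (hξ.condExp_terminal_ae_eq hc hsu huT (f := A.indicator 1)
    (measurable_one.indicator hA) (by
      refine ((lintegral_mono fun ω ↦ indicator_le_self' (fun _ _ ↦ zero_le) _).trans_lt ?_).ne
      simp)).2
  simp only [lintegral_indicator_one hA] at h
  have hind : (fun ω ↦ (A.indicator (1 : ℝ → ℝ≥0∞) (ξ T ω)).toReal) =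
      (ξ T ⁻¹' A).indicator fun _ ↦ (1 : ℝ) := by
    funext ω
    by_cases hω : ξ T ω ∈ A <;> simp [indicator, hω]
  rwa [hind] at h

/-- The conditional probability of the sure event is `1`, so the real-valued posterior mass is `1`;
this rules out the degenerate normalising constants `0` and `∞`. -/
lemma IsStableHalfRandomBridge.ae_isProbabilityMeasure_posterior
    (hξ : IsStableHalfRandomBridge Q c T ν ξ) (hc : 0 < c) (hsu : s < u) (huT : u < T) :
    ∀ᵐ ω ∂Q, IsProbabilityMeasure (posterior c T ν s (ξ s ω)) := by
  filter_upwards [hξ.condExp_indicator_ae_eq hc hsu huT MeasurableSet.univ] with ω hω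
  rw [preimage_univ, indicator_univ, condExp_const (Filtration.le _ s)] at hω
  refine ⟨?_⟩
  rwa [Measure.real, eq_comm, ENNReal.toReal_eq_one_iff] at hω

lemma IsStableHalfRandomBridge.ae_le_terminal (hξ : IsStableHalfRandomBridge Q c T ν ξ)
    (hc : 0 < c) (hsu : s < u) (huT : u < T) : ∀ᵐ ω ∂Q, ξ u ω ≤ ξ T ω := by
  have hm : ∀ u, Measurable (ξ u) := fun u ↦ (hξ.stronglyMeasurable u).measurable
  have hS : MeasurableSet {p : ℝ × ℝ | p.2 < p.1} := measurableSet_lt measurable_snd measurable_fst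
  have hφ : Measurable (Function.uncurry fun y z : ℝ ↦
      {p : ℝ × ℝ | p.2 < p.1}.indicator (1 : ℝ × ℝ → ℝ≥0∞) (y, z)) :=
    measurable_one.indicator hS
  have h := hξ.setLIntegral_eq hc hsu huT hφ (by
      refine ((lintegral_mono fun ω ↦ indicator_le_self' (fun _ _ ↦ zero_le) _).trans_lt ?_).ne
      simp) MeasurableSet.univ
  simp only [bridgeAvg_indicator_lt, lintegral_zero, setLIntegral_univ] at h
  filter_upwards [(lintegral_eq_zero_iff (hφ.comp ((hm u).prodMk (hm T)))).1 h] with ω hω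
  by_contra hlt
  simp [indicator, not_le.1 hlt] at hω

lemma IsStableHalfRandomBridge.ae_terminal_pos (hξ : IsStableHalfRandomBridge Q c T ν ξ)
    (hν : ∀ᵐ z ∂ν, 0 < z) : ∀ᵐ ω ∂Q, 0 < ξ T ω :=
  ae_of_ae_map (hξ.stronglyMeasurable T).measurable.aemeasurable (hξ.terminal_law ▸ hν)

lemma IsStableHalfRandomBridge.integrable_terminal (hξ : IsStableHalfRandomBridge Q c T ν ξ)
    (hν : Integrable (fun z ↦ z) ν) : Integrable (ξ T) Q := by
  rw [← hξ.terminal_law] at hν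
  exact hν.comp_measurable (hξ.stronglyMeasurable T).measurable

lemma IsStableHalfRandomBridge.integrable_max_sub (hξ : IsStableHalfRandomBridge Q c T ν ξ)
    (hν_pos : ∀ᵐ z ∂ν, 0 < z) (hν_int : Integrable (fun z ↦ z) ν) (hc : 0 < c) (hsu : s < u)
    (huT : u < T) {K : ℝ} (hK : 0 ≤ K) : Integrable (fun ω ↦ max (ξ u ω - K) 0) Q := by
  refine (hξ.integrable_terminal hν_int).mono'
    (((hξ.stronglyMeasurable u).measurable.sub_const K).max measurable_const).aestronglyMeasurable ?_
  filter_upwards [hξ.ae_le_terminal hc hsu huT, hξ.ae_terminal_pos hν_pos] with ω h1 h2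
  rw [Real.norm_of_nonneg (le_max_right _ _)]
  exact max_le (by linarith) h2.le

lemma IsStableHalfRandomBridge.ae_mean_posterior (hξ : IsStableHalfRandomBridge Q c T ν ξ)
    (hν_pos : ∀ᵐ z ∂ν, 0 < z) (hν_int : Integrable (fun z ↦ z) ν) (hc : 0 < c) (hsu : s < u)
    (huT : u < T) :
    ∀ᵐ ω ∂Q, Integrable (fun z ↦ z) (posterior c T ν s (ξ s ω)) ∧
      (Q[ξ T | Filtration.natural ξ hξ.stronglyMeasurable s]) ω =
        ∫ z, z ∂posterior c T ν s (ξ s ω) := by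
  -- The terminal value is positive, so nothing is lost in passing through `ℝ≥0∞`, where finiteness
  -- of the posterior mean comes with the conditional expectation.
  have hpos : ∀ᵐ ω ∂Q, (ENNReal.ofReal (ξ T ω)).toReal = ξ T ω := by
    filter_upwards [hξ.ae_terminal_pos hν_pos] with ω hω
    exact ENNReal.toReal_ofReal hω.le
  obtain ⟨h1, h2⟩ := hξ.condExp_terminal_ae_eq hc hsu huT ENNReal.measurable_ofReal
    (hξ.integrable_terminal hν_int).lintegral_lt_top.ne
  have h3 := condExp_congr_ae (m := Filtration.natural ξ hξ.stronglyMeasurable s) hpos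
  filter_upwards [h1, h2, h3] with ω h1 h2 h3
  have h4 : 0 ≤ᵐ[posterior c T ν s (ξ s ω)] fun z ↦ z := by
    filter_upwards [(posterior_absolutelyContinuous c T s (ξ s ω) ν).ae_le hν_pos] with z hz
    exact hz.le
  refine ⟨(lintegral_ofReal_ne_top_iff_integrable aestronglyMeasurable_id h4).1 h1.ne, ?_⟩
  rw [← h3, h2, integral_eq_lintegral_of_nonneg_ae h4 aestronglyMeasurable_id]

end CondExp

end StableHalf

/-! ### Assembly of the main theorem -/

open StableHalf in
theorem mainTheorem1 {Ω : Type*} [MeasurableSpace Ω] (Q : Measure Ω) [IsProbabilityMeasure Q]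
    (c : ℝ) (hc : 0 < c) (T : ℝ≥0) (ν : Measure ℝ)
    (hν_pos : ∀ᵐ z ∂ν, 0 < z) (hν_int : Integrable (fun z ↦ z) ν)
    (ξ : ℝ≥0 → Ω → ℝ) (hξ : StableHalf.IsStableHalfRandomBridge Q c T ν ξ)
    (s t : ℝ≥0) (hst : s < t) (htT : t < T) (K : ℝ) (hK : 0 < K) :
    -- `ν_s` is the `ℱ_s`-conditional law of `U_T = ξ_T`, with mean `U_s = E[U_T | ℱ_s]`
    (∀ A : Set ℝ, MeasurableSet A →
      Q⟦ξ T ⁻¹' A | Filtration.natural ξ hξ.stronglyMeasurable s⟧ =ᵐ[Q]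
        fun ω ↦ (StableHalf.posterior c T ν s (ξ s ω)).real A) ∧
    (∀ᵐ ω ∂Q, Integrable (fun z ↦ z) (StableHalf.posterior c T ν s (ξ s ω)) ∧
      (Q[ξ T | Filtration.natural ξ hξ.stronglyMeasurable s]) ω =
        ∫ z in Ioi (ξ s ω), z ∂(StableHalf.posterior c T ν s (ξ s ω))) ∧
    -- all the expectations and integrals in the formula exist
    Integrable (fun ω ↦ max (ξ t ω - K) 0) Q ∧
    (∀ᵐ ω ∂Q, ξ s ω < K →
      IntegrableOn (fun z ↦ StableHalf.bridgeCDF c (t - s) (T - s) (K - ξ s ω) (z - ξ s ω))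
        (Ioi (ξ s ω)) (StableHalf.posterior c T ν s (ξ s ω)) ∧
      IntegrableOn (fun z ↦ StableHalf.bridgeMoment c (t - s) (T - s) (K - ξ s ω) (z - ξ s ω))
        (Ioi (ξ s ω)) (StableHalf.posterior c T ν s (ξ s ω))) ∧
    -- the expected exceedence
    (Q[fun ω ↦ max (ξ t ω - K) 0 | Filtration.natural ξ hξ.stronglyMeasurable s] =ᵐ[Q]
      fun ω ↦
        ((T : ℝ) - t) / ((T : ℝ) - s) * ξ s ω
          + ((t : ℝ) - s) / ((T : ℝ) - s) *
              (Q[ξ T | Filtration.natural ξ hξ.stronglyMeasurable s]) ω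
          - K
          + {ω' | ξ s ω' < K}.indicator (fun ω' ↦
              (K - ξ s ω') * ∫ z in Ioi (ξ s ω'),
                StableHalf.bridgeCDF c (t - s) (T - s) (K - ξ s ω') (z - ξ s ω')
                  ∂(StableHalf.posterior c T ν s (ξ s ω'))) ω
          - {ω' | ξ s ω' < K}.indicator (fun ω' ↦
              ∫ z in Ioi (ξ s ω'),
                StableHalf.bridgeMoment c (t - s) (T - s) (K - ξ s ω') (z - ξ s ω')
                  ∂(StableHalf.posterior c T ν s (ξ s ω'))) ω) ∧
    -- closed forms of the distribution function and of the incomplete first moment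
    (∀ r R y z : ℝ, 0 < r → r < R → 0 < y → y < z →
      StableHalf.bridgeCDF c r R y z =
        StableHalf.Phi (c * (R * y - r * z) / √(y * z * (z - y)))
          + (1 - 2 * r / R) * Real.exp (2 * c ^ 2 * r * (R - r) / z)
            * StableHalf.Phi (c * ((2 * r - R) * y - r * z) / √(y * z * (z - y))) ∧
      StableHalf.bridgeMoment c r R y z =
        r / R * z *
          (StableHalf.Phi (c * (R * y - r * z) / √(y * z * (z - y)))
            - Real.exp (2 * c ^ 2 * r * (R - r) / z)
              * StableHalf.Phi (c * ((2 * r - R) * y - r * z) / √(y * z * (z - y))))) ∧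
    (∀ r R y z : ℝ, 0 < r → r < R → 0 < z → z ≤ y →
      StableHalf.bridgeCDF c r R y z = 1 ∧ StableHalf.bridgeMoment c r R y z = r / R * z) := by
  have hr : (0 : ℝ) < t - s := sub_pos.2 (by exact_mod_cast hst)
  have hR : (t : ℝ) - s < T - s := sub_lt_sub_right (by exact_mod_cast htT) _
  have hprob := hξ.ae_isProbabilityMeasure_posterior hc hst htT
  have hmean := hξ.ae_mean_posterior hν_pos hν_int hc hst htT
  -- The posterior charges only `(ξ_s, ∞)`, so the restrictions in the statement can be dropped.
  have hself : ∀ x, (posterior c T ν s x).restrict (Ioi x) = posterior c T ν s x := fun x ↦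
    Measure.restrict_eq_self_of_ae_mem (ae_lt_posterior c T s x ν)
  have hint := hξ.integrable_max_sub hν_pos hν_int hc hst htT hK.le
  simp only [IntegrableOn, hself]
  refine ⟨fun A hA ↦ hξ.condExp_indicator_ae_eq hc hst htT hA, hmean, hint, ?_, ?_, ?_, ?_⟩
  · filter_upwards [hprob, hmean] with ω hω1 hω2 hω3
    have hlt := ae_lt_posterior c T s (ξ s ω) ν
    exact ⟨integrable_bridgeCDF_sub hc hr hR hlt _,
      integrable_bridgeMoment_sub hc hr hR hlt hω2.1 (sub_nonneg.2 hω3.le)⟩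
  · have h := (hξ.condExp_ae_eq hc hst htT (φ := fun y _ ↦ ENNReal.ofReal (max (y - K) 0))
      (((measurable_fst.sub_const K).max measurable_const).ennreal_ofReal)
      hint.lintegral_lt_top.ne).2
    simp only [ENNReal.toReal_ofReal (le_max_right _ _)] at h
    filter_upwards [h, hprob, hmean] with ω h hω1 hω2
    have hlt := ae_lt_posterior c T s (ξ s ω) ν
    have hnn : 0 ≤ᵐ[posterior c T ν s (ξ s ω)] fun z ↦
        bridgeExceedance c (t - s) (T - s) (K - ξ s ω) (z - ξ s ω) := by
      filter_upwards [hlt] with z hz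
      exact bridgeExceedance_nonneg hc hr hR (sub_pos.2 hz) _
    have hav : ∫⁻ z, bridgeAvg c (t - s) (T - s) (fun y _ ↦ ENNReal.ofReal (max (y - K) 0))
        (ξ s ω) z ∂posterior c T ν s (ξ s ω) = ∫⁻ z, ENNReal.ofReal
          (bridgeExceedance c (t - s) (T - s) (K - ξ s ω) (z - ξ s ω))
            ∂posterior c T ν s (ξ s ω) := by
      refine lintegral_congr_ae ?_
      filter_upwards [hlt] with z hz
      exact bridgeAvg_max_sub hc hr hR hz K
    rw [h, hav, ← integral_eq_lintegral_of_nonneg_ae hnn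
      (integrable_bridgeExceedance_sub hc hr hR hlt hω2.1 _).aestronglyMeasurable,
      integral_bridgeExceedance_sub hc hr hR hlt hω2.1, hω2.2]
    have hTs : (T : ℝ) - s ≠ 0 := (hr.trans hR).ne'
    -- The bridge mean measured from `ξ_s` becomes the interpolation between `ξ_s` and `U_s`, by `1
    -- - (t - s)/(T - s) = (T - t)/(T - s)`.
    have hlin : ∀ m : ℝ, ((t : ℝ) - s) / (T - s) * (m - ξ s ω) - (K - ξ s ω) =
        ((T : ℝ) - t) / (T - s) * ξ s ω + ((t : ℝ) - s) / (T - s) * m - K := fun m ↦ by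
      field_simp
      ring
    rw [hlin]
    by_cases hk : ξ s ω < K
    · simp only [sub_pos, hk, if_true, indicator, mem_ofPred_eq]
      ring
    · simp [sub_pos, hk, indicator]
  · intro r R y z hr hR hy hyz
    refine ⟨?_, ?_⟩
    · rw [bridgeCDF_of_lt hc hr hR hy hyz]
      rfl
    · rw [bridgeMoment_of_lt hc hr hR hy hyz, closedForm, neg_one_mul, neg_mul, ← sub_eq_add_neg]
      rfl
  · exact fun r R y z hr hR hz hzy ↦
      ⟨bridgeCDF_of_le hc hr hR hz hzy, bridgeMoment_of_le hc hr hR hz hzy⟩
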